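/- Let $\sigma$ be a finite relational signature in which every relation symbol $R$ has arity $\operatorname{arity}(R)\ge 1$, and let $\mathbf A,\mathbf B$ be finite $\sigma$-structures with universes $A,B$. Definitions. For a $\sigma$-structure $\mathbf A$ let $\mathcal C_{\mathbf A}$ be the set of its constraints $R(\mathbf a)$, that is, of the pairs $(\mathbf a,R)$ with $R\in\sigma$ and $\mathbf a\in R(\mathbf A)$. A label is a pair $\ell=(S,R)$ with $R\in\sigma$ and $S\subseteq\{1,\dots,\operatorname{arity}(R)\}$. For $a\in A$ and $R(\mathbf a)\in\mathcal C_{\mathbf A}$ put $M_{\mathbf A}[a,R(\mathbf a)]=(\{i: \mathbf a[i]=a\},R)$, and let $M_{\mathbf A}^\ell\in\{0,1\}^{A\times\mathcal C_{\mathbf A}}$ have entry $1$ exactly where $M_{\mathbf A}$ has entry $\ell$. A doubly stochastic matrix is a square matrix (rows and columns may be indexed by different sets of the same size) with nonnegative real entries all of whose row sums and column sums equal $1$. The iterated degrees $\delta_k^{\mathbf A}$ of elements and constraints are defined as follows: $\delta_0^{\mathbf A}$ takes one fixed value on $A$ and another one on $\mathcal C_{\mathbf A}$ (the same two values for all structures);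 for $k\ge1$, $\delta_k^{\mathbf A}(a)$ is the multiset of all $(\ell,\delta_{k-1}^{\mathbf A}(C))$ with $\ell$ a label, $C\in\mathcal C_{\mathbf A}$ and $M^\ell_{\mathbf A}[a,C]=1$, and $\delta_k^{\mathbf A}(C)$ is the multiset of all $(\ell,\delta_{k-1}^{\mathbf A}(a))$ with $\ell$ a label, $a\in A$ and $M^\ell_{\mathbf A}[a,C]=1$. The structures have the same iterated degree sequence if for every $k\ge0$ the multisets of the values of $\delta_k^{\mathbf A}$ on $A\cup\mathcal C_{\mathbf A}$ and of $\delta_k^{\mathbf B}$ on $B\cup\mathcal C_{\mathbf B}$ are equal. A partition $\{P_i\}_{i\in I}$ of $A$ together with a partition $\{Q_j\}_{j\in J}$ of $\mathcal C_{\mathbf A}$ is equitable with parameters $c^\ell_{i,j},d^\ell_{j,i}$ if for all $i\in I$, $j\in J$ and all labels $\ell$: $|\{C\in Q_j: M_{\mathbf A}[a,C]=\ell\}|=c^\ell_{i,j}$ for every $a\in P_i$, and $|\{a\in P_i: M_{\mathbf A}[a,C]=\ell\}|=d^\ell_{j,i}$ for every $C\in Q_j$. The structures have a common equitable partition if there are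 equitable partitions $(\{P^{\mathbf A}_i\}_{i\in I},\{Q^{\mathbf A}_j\}_{j\in J})$ of $\mathbf A$ and $(\{P^{\mathbf B}_i\}_{i\in I},\{Q^{\mathbf B}_j\}_{j\in J})$ of $\mathbf B$, indexed by the same sets and with the same parameters, such that $|P^{\mathbf A}_i|=|P^{\mathbf B}_i|$ for all $i\in I$ and $|Q^{\mathbf A}_j|=|Q^{\mathbf B}_j|$ for all $j\in J$. The factor graph of a structure $\mathbf T$ is the simple bipartite graph on $T\cup\mathcal C_{\mathbf T}$ in which each constraint $R(\mathbf t)$ is adjacent to exactly the elements occurring in $\mathbf t$. A factor-tree is a finite $\sigma$-structure whose factor graph is a tree. $\mathrm{Hom}(\mathbf T,\mathbf A)$ is the number of homomorphisms from $\mathbf T$ to $\mathbf A$. Theorem. The following are equivalent: 1. there are doubly stochastic matrices $X\in\mathbb R^{B\times A}$ and $Y\in\mathbb R^{\mathcal C_{\mathbf B}\times\mathcal C_{\mathbf A}}$ such that $XM_{\mathbf A}^\ell=M_{\mathbf B}^\ell Y$ and $M_{\mathbf A}^\ell Y^T=X^TM_{\mathbf B}^\ell$ for every label $\ell$; 2.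 $\mathbf A$ and $\mathbf B$ have the same iterated degree sequence; 3. $\mathbf A$ and $\mathbf B$ have a common equitable partition; 4. $\mathrm{Hom}(\mathbf T,\mathbf A)=\mathrm{Hom}(\mathbf T,\mathbf B)$ for every factor-tree $\mathbf T$ over $\sigma$. If, in addition, $\mathbf A$ and $\mathbf B$ are graphs (that is, $\sigma$ consists of a single binary relation symbol, interpreted in both structures by a symmetric and irreflexive relation), then these conditions are also equivalent to: 5. there is a doubly stochastic matrix $X\in\mathbb R^{B\times A}$ with $XN_{\mathbf A}=N_{\mathbf B}X$, where $N_{\mathbf A},N_{\mathbf B}$ are the adjacency matrices of $\mathbf A,\mathbf B$. -/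

import Mathlib

open scoped FirstOrder

namespace FracIso

universe u v w

/-- The relation symbols of the signature `σ`, each bundled with its arity `R.1`. -/
abbrev RelSymbol (σ : FirstOrder.Language.{u, v}) : Type v := Σ n : ℕ, σ.Relations n

/-- The constraints `R(a)` of a structure `A`: a relation symbol `R` together with a tuple `a`
belonging to the interpretation of `R` in `A`. -/
structure Constraint (σ : FirstOrder.Language.{u, v}) (A : Type w) [σ.Structure A] where
  /-- the relation symbol of the constraint -/
  sym : RelSymbol σ
  /-- the tuple of the constraint -/
  tuple : Fin sym.1 → A
  /-- the tuple belongs to the relation -/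
  holds : FirstOrder.Language.Structure.RelMap sym.2 tuple

instance (σ : FirstOrder.Language.{u, v}) [Finite (RelSymbol σ)] (A : Type w) [σ.Structure A] [Finite A] :
    Finite (Constraint σ A) :=
  Finite.of_injective
    (fun c : Constraint σ A => (⟨c.sym, c.tuple⟩ : Σ R : RelSymbol σ, Fin R.1 → A))
    (fun c d h => by cases c; cases d; cases h; rfl)

noncomputable instance (σ : FirstOrder.Language.{u, v}) [Finite (RelSymbol σ)] (A : Type w) [σ.Structure A]
    [Finite A] : Fintype (Constraint σ A) :=
  Fintype.ofFinite _

/-- The factor graph of `A`: the bipartite simple graph on elements and constraints where each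
constraint is joined to every element that occurs in its tuple. -/
def factorGraph (σ : FirstOrder.Language.{u, v}) (A : Type w) [σ.Structure A] :
    SimpleGraph (A ⊕ Constraint σ A) where
  Adj
    | .inl a, .inr c => a ∈ Set.range c.tuple
    | .inr c, .inl a => a ∈ Set.range c.tuple
    | _, _ => False
  symm := ⟨by rintro (a | c) (b | d) h <;> exact h⟩
  loopless := ⟨by rintro (a | c) h <;> exact h⟩

/-- A structure is an ftree if its factor graph is a tree. -/
def IsFTree (σ : FirstOrder.Language.{u, v}) (T : Type w) [σ.Structure T] : Prop :=
  (factorGraph σ T).IsTree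

/-- Labels: pairs of a relation symbol `R` and a subset `S` of the positions of `R`. -/
abbrev Label (σ : FirstOrder.Language.{u, v}) : Type v := Σ R : RelSymbol σ, Finset (Fin R.1)

open scoped Classical in
/-- The matrix representation of `A`: the entry at `(a, R(t))` is the label `(S, R)` where `S` is
the set of positions of the tuple `t` that hold the element `a`. -/
noncomputable def labelMatrix (σ : FirstOrder.Language.{u, v}) (A : Type w) [σ.Structure A] :
    Matrix A (Constraint σ A) (Label σ) :=
  fun a c => ⟨c.sym, Finset.univ.filter fun i => a = c.tuple i⟩

open scoped Classical in
/-- The 0-1 incidence matrix of `A` for the label `ℓ`. -/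
noncomputable def incMatrix (σ : FirstOrder.Language.{u, v}) (A : Type w) [σ.Structure A] (ℓ : Label σ) :
    Matrix A (Constraint σ A) ℝ :=
  fun a c => if labelMatrix σ A a c = ℓ then 1 else 0

/-- A doubly stochastic matrix, rows and columns being indexed by arbitrary finite types of the
same cardinality: nonnegative entries, and all row sums and column sums equal to `1`. -/
structure IsDoublyStochastic {m : Type u} {n : Type v} [Fintype m] [Fintype n]
    (X : Matrix m n ℝ) : Prop where
  square : Fintype.card m = Fintype.card n
  nonneg : ∀ i j, 0 ≤ X i j
  row_sum : ∀ i, ∑ j, X i j = 1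
  col_sum : ∀ j, ∑ i, X i j = 1

/-- The possible values of the `k`-th iterated degree: two symbols for `k = 0`, and multisets of
pairs of a label and a `k`-th iterated degree for `k + 1`. -/
def Degree (σ : FirstOrder.Language.{u, v}) : ℕ → Type v
  | 0 => ULift.{v} Bool
  | k + 1 => Multiset (Label σ × Degree σ k)

/-- The `k`-th iterated degree of the elements and constraints of `A`. Each pair `(a, c)` of an
element and a constraint has exactly one label `ℓ`, so the multiset of all `(ℓ, δ c)` with
`M^ℓ[a, c] = 1` is indexed by the constraints `c`, and likewise for the elements. -/
noncomputable def iterDegree (σ : FirstOrder.Language.{u, v}) [Finite (RelSymbol σ)] (A : Type w)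
    [σ.Structure A] [Fintype A] : (k : ℕ) → A ⊕ Constraint σ A → Degree σ k
  | 0, .inl _ => ULift.up true
  | 0, .inr _ => ULift.up false
  | k + 1, .inl a =>
      (Finset.univ : Finset (Constraint σ A)).val.map
        fun c => (labelMatrix σ A a c, iterDegree σ A k (.inr c))
  | k + 1, .inr c =>
      (Finset.univ : Finset A).val.map
        fun a => (labelMatrix σ A a c, iterDegree σ A k (.inl a))

/-- `A` and `B` have the same iterated degree sequence. -/
def SameIterDegree (σ : FirstOrder.Language.{u, v}) [Finite (RelSymbol σ)] (A B : Type*)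
    [σ.Structure A] [σ.Structure B] [Fintype A] [Fintype B] : Prop :=
  ∀ k : ℕ,
    (Finset.univ : Finset (A ⊕ Constraint σ A)).val.map (iterDegree σ A k) =
      (Finset.univ : Finset (B ⊕ Constraint σ B)).val.map (iterDegree σ B k)

open scoped Classical in
/-- `p : A → I` and `q : Constraint σ A → J` represent the partitions of the elements and of the
constraints into their (nonempty) fibres `P_i = p ⁻¹' {i}` and `Q_j = q ⁻¹' {j}`. This says that
the pair is an equitable partition with parameters `c i j ℓ` and `d j i ℓ`. -/
structure IsEquitable (σ : FirstOrder.Language.{u, v}) [Finite (RelSymbol σ)] (A : Type w)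
    [σ.Structure A] [Fintype A] {I J : Type} (p : A → I) (q : Constraint σ A → J)
    (c : I → J → Label σ → ℕ) (d : J → I → Label σ → ℕ) : Prop where
  surj_p : Function.Surjective p
  surj_q : Function.Surjective q
  card_constraints : ∀ (a : A) (j : J) (ℓ : Label σ),
    (Finset.univ.filter fun C : Constraint σ A => q C = j ∧ labelMatrix σ A a C = ℓ).card
      = c (p a) j ℓ
  card_elements : ∀ (C : Constraint σ A) (i : I) (ℓ : Label σ),
    (Finset.univ.filter fun a : A => p a = i ∧ labelMatrix σ A a C = ℓ).card
      = d (q C) i ℓ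

open scoped Classical in
/-- `A` and `B` have a common equitable partition: equitable partitions indexed by the same sets,
with the same parameters and with corresponding classes of equal size. -/
def HaveCommonEquitablePartition (σ : FirstOrder.Language.{u, v}) [Finite (RelSymbol σ)] (A B : Type*)
    [σ.Structure A] [σ.Structure B] [Fintype A] [Fintype B] : Prop :=
  ∃ (I J : Type) (pA : A → I) (qA : Constraint σ A → J) (pB : B → I) (qB : Constraint σ B → J)
    (c : I → J → Label σ → ℕ) (d : J → I → Label σ → ℕ),
    IsEquitable σ A pA qA c d ∧ IsEquitable σ B pB qB c d ∧
    (∀ i, (Finset.univ.filter fun a => pA a = i).card =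
      (Finset.univ.filter fun b => pB b = i).card) ∧
    (∀ j, (Finset.univ.filter fun C => qA C = j).card =
      (Finset.univ.filter fun C => qB C = j).card)

/-- There are doubly stochastic `X`, `Y` with `X M_A^ℓ = M_B^ℓ Y` and `M_A^ℓ Yᵀ = Xᵀ M_B^ℓ` for
every label `ℓ`. -/
def MatrixCondition (σ : FirstOrder.Language.{u, v}) [Finite (RelSymbol σ)] (A B : Type*)
    [σ.Structure A] [σ.Structure B] [Fintype A] [Fintype B] : Prop :=
  ∃ (X : Matrix B A ℝ) (Y : Matrix (Constraint σ B) (Constraint σ A) ℝ),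
    IsDoublyStochastic X ∧ IsDoublyStochastic Y ∧
    ∀ ℓ : Label σ, X * incMatrix σ A ℓ = incMatrix σ B ℓ * Y ∧
      incMatrix σ A ℓ * Y.transpose = X.transpose * incMatrix σ B ℓ

/-- Every (finite) ftree has equally many homomorphisms to `A` and to `B`. As every finite
structure is isomorphic to one whose universe lives in `Type`, it is enough to range over these. -/
def SameFTreeHoms (σ : FirstOrder.Language.{u, v}) (A B : Type*) [σ.Structure A] [σ.Structure B] : Prop :=
  ∀ (T : Type) [Finite T] [σ.Structure T], IsFTree σ T →
    Nat.card (T →[σ] A) = Nat.card (T →[σ] B)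

/-- `A` is a graph with edge relation `E`: the binary symbol `E` is the only symbol of the
signature, and its interpretation is symmetric and irreflexive. -/
structure IsGraph (σ : FirstOrder.Language.{u, v}) (E : σ.Relations 2) (A : Type w) [σ.Structure A] :
    Prop where
  only_symbol : ∀ R : RelSymbol σ, R = ⟨2, E⟩
  symm : ∀ a b : A, FirstOrder.Language.Structure.RelMap E ![a, b] → FirstOrder.Language.Structure.RelMap E ![b, a]
  irrefl : ∀ a : A, ¬ FirstOrder.Language.Structure.RelMap E ![a, a]

open scoped Classical in
/-- The adjacency matrix of the binary relation `E` on `A`. -/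
noncomputable def adjMatrix (σ : FirstOrder.Language.{u, v}) (E : σ.Relations 2) (A : Type w)
    [σ.Structure A] : Matrix A A ℝ :=
  fun a b => if FirstOrder.Language.Structure.RelMap E ![a, b] then 1 else 0

/-- There is a doubly stochastic `X` with `X N_A = N_B X`. -/
def AdjCondition (σ : FirstOrder.Language.{u, v}) (E : σ.Relations 2) (A B : Type*)
    [σ.Structure A] [σ.Structure B] [Fintype A] [Fintype B] : Prop :=
  ∃ X : Matrix B A ℝ, IsDoublyStochastic X ∧ X * adjMatrix σ E A = adjMatrix σ E B * X

end FracIso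

/-! The common equitable partition (3) is the hub: the cycle 1 → 2 → 3 → 1, then 3 ↔ 4, and for
graphs 1 → 5 → 3.

1 → 2: if `X` is doubly stochastic, `X f = g` and `Xᵀ g = f`, then `∑ X i j (g i - f j)² = 0`, so
`f` and `g` agree along the support of `X` (`Matched`). The matrix equations carry matched pairs to
matched pairs (`Matched.mulVec`), and a refinement step counts labelled incidences with colour
classes, so all iterated degrees are matched. Matched colourings have classes of equal size.

2 → 3: iterated degrees refine each other, hence stabilise on finite structures; the stable classes
are equitable. Positive arity keeps elements and constraints apart.

3 → 1: take matrices uniform on corresponding classes; double counting incidences between two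
classes gives the equations.

3 → 4: a homomorphism from `T` is an assignment on its factor graph, constrained along the edges.
When the factor graph is a tree, leaves are summed out one at a time; equitability makes each
resulting factor a function of the colour, the same for both structures
(`edgeConstrainedSum_eq_of_isTree`).

4 → 3: consider the functions on `A ⊕ B` counting homomorphisms from rooted factor-trees. They are
closed under products (glue at the roots), so their rational span contains the indicators of the
classes they do not separate (`indicator_mem_span`). Each function in the span has equal sums over
`A` and `B`, so these classes have equal sizes. Gluing trees to the entries of a single constraint
shows that the number of tuples through an element with given entry colours and equality pattern is
in the span (`patternCount_mem_span`), hence constant on classes. Such a colouring of elements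
extends to constraints (`haveCommonEquitablePartition_of_patternCount`).

1 → 5 factors the adjacency matrix through two incidence matrices. 5 → 3 colours the vertices by the
values of all matched functions, which the adjacency matrices preserve. -/

namespace FracIso

universe u v w

/-! ### Fibre counts, multisets and colour-preserving bijections. -/

section Counting

theorem card_filter_eq_of_equiv {α β : Type*} [Fintype α] [Fintype β] (e : α ≃ β)
    {P : α → Prop} {Q : β → Prop} [DecidablePred P] [DecidablePred Q]
    (h : ∀ x, P x ↔ Q (e x)) :
    (Finset.univ.filter P).card = (Finset.univ.filter Q).card := by
  refine Finset.card_equiv e fun x => ?_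
  simp [h]

theorem exists_equiv_of_card_fibres {α β γ : Type*} [Fintype α] [Fintype β] [DecidableEq γ]
    {f : α → γ}
    {g : β → γ}
    (h : ∀ c, (Finset.univ.filter fun x => f x = c).card =
      (Finset.univ.filter fun y => g y = c).card) :
    ∃ e : α ≃ β, ∀ x, g (e x) = f x := by
  have key : ∀ c, Nonempty ({a // f a = c} ≃ {b // g b = c}) := fun c => by
    rw [← Fintype.card_eq, Fintype.card_subtype, Fintype.card_subtype, h c]
  exact ⟨Equiv.ofFiberEquiv fun c => (key c).some, fun x => Equiv.ofFiberEquiv_map _ x⟩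

theorem map_univ_eq_of_equiv {α β γ : Type*} [Fintype α] [Fintype β] {f : α → γ} {g : β → γ}
    (e : α ≃ β) (h : ∀ x, g (e x) = f x) :
    (Finset.univ : Finset α).val.map f = (Finset.univ : Finset β).val.map g := by
  have : f = g ∘ e := funext fun x => (h x).symm
  rw [this, ← Multiset.map_map]
  congr 1
  simp

open scoped Classical in
theorem exists_equiv_of_map_univ_eq {α β γ : Type*} [Fintype α] [Fintype β] {f : α → γ}
    {g : β → γ}
    (h : (Finset.univ : Finset α).val.map f = (Finset.univ : Finset β).val.map g) :
    ∃ e : α ≃ β, ∀ x, g (e x) = f x := by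
  refine exists_equiv_of_card_fibres fun c => ?_
  have := congrArg (Multiset.count c) h
  rw [Multiset.count_map, Multiset.count_map] at this
  simpa [Finset.card_def, eq_comm] using this

/-- If two functions on equinumerous types have equally many preimages of every value but one,
then the same holds for the remaining value. -/
theorem card_fibre_eq_of_forall_ne {α β γ : Type*} [Fintype γ] [DecidableEq γ]
    {s : Finset α} {t : Finset β}
    {f : α → γ} {g : β → γ} (hst : s.card = t.card) (c₀ : γ)
    (h : ∀ c, c ≠ c₀ → (s.filter fun x => f x = c).card = (t.filter fun y => g y = c).card)
    (c : γ) : (s.filter fun x => f x = c).card = (t.filter fun y => g y = c).card := by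
  by_cases hc : c = c₀
  · subst hc
    have h1 := Finset.card_eq_sum_card_fiberwise (s := s) (t := Finset.univ) (f := f) (by simp)
    have h2 := Finset.card_eq_sum_card_fiberwise (s := t) (t := Finset.univ) (f := g) (by simp)
    rw [← Finset.add_sum_erase _ _ (Finset.mem_univ c)] at h1 h2
    have h3 : ∑ x ∈ Finset.univ.erase c, (s.filter fun y => f y = x).card =
        ∑ x ∈ Finset.univ.erase c, (t.filter fun y => g y = x).card :=
      Finset.sum_congr rfl fun x hx => h x (Finset.ne_of_mem_erase hx)
    omega
  · exact h c hc

end Counting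

/-! ### From colourings to common equitable partitions. -/

section Colourings

variable {σ : FirstOrder.Language.{u, v}} [Finite (RelSymbol σ)]

open scoped Classical in
/-- Colourings with equally large classes factor through a common finite set of colours. -/
theorem exists_fin_factorization {A B I : Type*} [Fintype A] [Fintype B] (p : A → I) (q : B → I)
    (h : ∀ i, (Finset.univ.filter fun a => p a = i).card =
      (Finset.univ.filter fun b => q b = i).card) :
    ∃ (n : ℕ) (ι : Fin n → I) (p' : A → Fin n) (q' : B → Fin n), Function.Injective ι ∧
      (∀ a, ι (p' a) = p a) ∧ (∀ b, ι (q' b) = q b) ∧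
      Function.Surjective p' ∧ Function.Surjective q' := by
  obtain ⟨e, he⟩ := exists_equiv_of_card_fibres h
  obtain ⟨n, ⟨f⟩⟩ := Finite.exists_equiv_fin (Set.range p)
  refine ⟨n, fun i => (f.symm i).1, fun a => f ⟨p a, a, rfl⟩,
    fun b => f ⟨q b, e.symm b, by rw [← he]; simp⟩, ?_, by simp, by simp, ?_, ?_⟩
  · exact Subtype.val_injective.comp f.symm.injective
  · intro i
    obtain ⟨a, ha⟩ := (f.symm i).2
    exact ⟨a, by rw [← Equiv.eq_symm_apply]; exact Subtype.ext ha⟩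
  · intro i
    obtain ⟨a, ha⟩ := (f.symm i).2
    exact ⟨e a, by rw [← Equiv.eq_symm_apply]; exact Subtype.ext ((he a).trans ha)⟩

open scoped Classical in
/-- A pair of colourings with classes of equal sizes in the two structures, and with equal numbers
of incidences between the structures, gives a common equitable partition. -/
theorem haveCommonEquitablePartition_of_colouring {A B : Type*} [σ.Structure A] [σ.Structure B]
    [Fintype A] [Fintype B] {I J : Type*} (pA : A → I) (pB : B → I)
    (qA : Constraint σ A → J) (qB : Constraint σ B → J)
    (hp : ∀ i, (Finset.univ.filter fun a => pA a = i).card =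
      (Finset.univ.filter fun b => pB b = i).card)
    (hq : ∀ j, (Finset.univ.filter fun C => qA C = j).card =
      (Finset.univ.filter fun D => qB D = j).card)
    (hc : ∀ a b, pA a = pB b → ∀ j ℓ,
      (Finset.univ.filter fun C => qA C = j ∧ labelMatrix σ A a C = ℓ).card =
        (Finset.univ.filter fun D => qB D = j ∧ labelMatrix σ B b D = ℓ).card)
    (hd : ∀ C D, qA C = qB D → ∀ i ℓ,
      (Finset.univ.filter fun a => pA a = i ∧ labelMatrix σ A a C = ℓ).card =
        (Finset.univ.filter fun b => pB b = i ∧ labelMatrix σ B b D = ℓ).card) :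
    HaveCommonEquitablePartition σ A B := by
  -- The index sets must lie in `Type` and all classes must be nonempty, so the colours are cut down
  -- to the finitely many that occur.
  obtain ⟨n, ι, p', r', hι, hp1, hp2, hps, hrs⟩ := exists_fin_factorization pA pB hp
  obtain ⟨m, κ, q', s', hκ, hq1, hq2, hqs, hss⟩ := exists_fin_factorization qA qB hq
  have eA : ∀ a i, p' a = i ↔ pA a = ι i := fun a i => by rw [← hp1, hι.eq_iff]
  have eB : ∀ a i, r' a = i ↔ pB a = ι i := fun a i => by rw [← hp2, hι.eq_iff]
  have fA : ∀ a i, q' a = i ↔ qA a = κ i := fun a i => by rw [← hq1, hκ.eq_iff]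
  have fB : ∀ a i, s' a = i ↔ qB a = κ i := fun a i => by rw [← hq2, hκ.eq_iff]
  choose β hβ using hrs
  choose δ hδ using hss
  refine ⟨Fin n, Fin m, p', q', r', s',
    -- The parameters are read off at representatives `β i` and `δ j` in `B`.
    fun i j ℓ => (Finset.univ.filter fun D => s' D = j ∧ labelMatrix σ B (β i) D = ℓ).card,
    fun j i ℓ => (Finset.univ.filter fun b => r' b = i ∧ labelMatrix σ B b (δ j) = ℓ).card,
    ⟨hps, hqs, fun a j ℓ => ?_, fun C i ℓ => ?_⟩,
    ⟨fun i => ⟨_, hβ i⟩, fun i => ⟨_, hδ i⟩, fun a j ℓ => ?_, fun C i ℓ => ?_⟩,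
    fun i => ?_, fun j => ?_⟩
  · simp only [fA, fB]
    exact hc _ _ (by rw [← hp1, ← hp2, hβ]) _ _
  · simp only [eA, eB]
    exact hd _ _ (by rw [← hq1, ← hq2, hδ]) _ _
  -- The hypotheses compare only `A` with `B`, so two elements of `B` are compared through one of
  -- `A`.
  · obtain ⟨a', ha'⟩ := hps (r' a)
    simp only [fB]
    exact (hc a' _ (by rw [← hp1, ← hp2, ha']) _ _).symm.trans
      (hc a' _ (by rw [← hp1, ← hp2, hβ, ha']) _ _)
  · obtain ⟨C', hC'⟩ := hqs (s' C)
    simp only [eB]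
    exact (hd C' _ (by rw [← hq1, ← hq2, hC']) _ _).symm.trans
      (hd C' _ (by rw [← hq1, ← hq2, hδ, hC']) _ _)
  · simp only [eA, eB]; exact hp _
  · simp only [fA, fB]; exact hq _

end Colourings

/-! ### Functions that agree along the support of a doubly stochastic matrix. -/

section DoublyStochastic

/-- The functions `f` and `g` agree along the support of the matrix `X`. -/
def Matched {m n γ : Type*} (X : Matrix m n ℝ) (f : n → γ) (g : m → γ) : Prop :=
  ∀ i j, 0 < X i j → g i = f j

variable {m n m' n' : Type*} {X : Matrix m n ℝ}

theorem Matched.transpose {γ : Type*} {f : n → γ} {g : m → γ} (h : Matched X f g) :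
    Matched X.transpose g f := fun i j hij => (h j i hij).symm

open scoped Classical in
theorem Matched.indicator {γ : Type*} {f : n → γ} {g : m → γ} (h : Matched X f g) (c : γ) :
    Matched X (fun j => if f j = c then (1 : ℝ) else 0) (fun i => if g i = c then (1 : ℝ) else 0) :=
  fun i j hij => by simp only [h i j hij]

variable [Fintype m] [Fintype n] [Fintype m'] [Fintype n']

theorem IsDoublyStochastic.transpose (hX : IsDoublyStochastic X) :
    IsDoublyStochastic X.transpose :=
  ⟨hX.square.symm, fun i j => hX.nonneg j i, hX.col_sum, hX.row_sum⟩

theorem IsDoublyStochastic.mulVec_of_matched (hX : IsDoublyStochastic X) {f : n → ℝ} {g : m → ℝ}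
    (h : Matched X f g) : X.mulVec f = g := by
  funext i
  have : ∀ j, X i j * f j = X i j * g i := fun j => by
    rcases (hX.nonneg i j).eq_or_lt with h0 | h0
    · rw [← h0, zero_mul, zero_mul]
    · rw [h i j h0]
  simp only [Matrix.mulVec, dotProduct, this, ← Finset.sum_mul, hX.row_sum, one_mul]

/-- Expand `∑ X i j (g i - f j)²`. The row and column sums turn the square terms into `∑ g²` and `∑
f²`, and the cross term equals `∑ g²` by `h₁` and `∑ f²` by `h₂`. The sum therefore vanishes, and so
does each of its nonnegative terms. -/
theorem IsDoublyStochastic.matched_of_mulVec (hX : IsDoublyStochastic X) {f : n → ℝ} {g : m → ℝ}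
    (h₁ : X.mulVec f = g) (h₂ : X.transpose.mulVec g = f) : Matched X f g := by
  have e1 : ∑ i, ∑ j, X i j * (g i * f j) = ∑ i, g i * g i := by
    refine Finset.sum_congr rfl fun i _ => ?_
    have := congrFun h₁ i
    simp only [Matrix.mulVec, dotProduct] at this
    calc ∑ j, X i j * (g i * f j) = g i * ∑ j, X i j * f j := by
          rw [Finset.mul_sum]; exact Finset.sum_congr rfl fun i _ => by ring
      _ = g i * g i := by rw [this]
  have e2 : ∑ i, ∑ j, X i j * (g i * f j) = ∑ j, f j * f j := by
    rw [Finset.sum_comm]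
    refine Finset.sum_congr rfl fun j _ => ?_
    have := congrFun h₂ j
    simp only [Matrix.mulVec, dotProduct, Matrix.transpose_apply] at this
    calc ∑ i, X i j * (g i * f j) = (∑ i, X i j * g i) * f j := by
          rw [Finset.sum_mul]; exact Finset.sum_congr rfl fun i _ => by ring
      _ = f j * f j := by rw [this]
  have e3 : ∑ i, ∑ j, X i j * (g i * g i) = ∑ i, g i * g i :=
    Finset.sum_congr rfl fun i _ => by rw [← Finset.sum_mul, hX.row_sum, one_mul]
  have e4 : ∑ i, ∑ j, X i j * (f j * f j) = ∑ j, f j * f j := by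
    rw [Finset.sum_comm]
    exact Finset.sum_congr rfl fun i _ => by rw [← Finset.sum_mul, hX.col_sum, one_mul]
  have key : ∑ i, ∑ j, X i j * (g i - f j) ^ 2 = 0 := by
    have : ∑ i, ∑ j, X i j * (g i - f j) ^ 2 = ∑ i, ∑ j, X i j * (g i * g i)
        - ∑ i, ∑ j, X i j * (g i * f j) - ∑ i, ∑ j, X i j * (g i * f j)
        + ∑ i, ∑ j, X i j * (f j * f j) := by
      simp only [← Finset.sum_sub_distrib, ← Finset.sum_add_distrib]
      exact Finset.sum_congr rfl fun i _ => Finset.sum_congr rfl fun j _ => by ring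
    rw [this, e3, e4, ← e1, e2]; ring
  intro i j hij
  have hnn : ∀ i j, 0 ≤ X i j * (g i - f j) ^ 2 := fun i j =>
    mul_nonneg (hX.nonneg i j) (sq_nonneg _)
  have h1 := (Finset.sum_eq_zero_iff_of_nonneg
    (fun i _ => Finset.sum_nonneg fun j _ => hnn i j)).1 key i (Finset.mem_univ _)
  have h2 := (Finset.sum_eq_zero_iff_of_nonneg (fun j _ => hnn i j)).1 h1 j (Finset.mem_univ _)
  have := (mul_eq_zero.1 h2).resolve_left hij.ne'
  exact sub_eq_zero.1 (pow_eq_zero_iff (two_ne_zero)|>.1 this)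

theorem IsDoublyStochastic.sum_eq_of_matched (hX : IsDoublyStochastic X) {f : n → ℝ} {g : m → ℝ}
    (h : Matched X f g) : ∑ j, f j = ∑ i, g i := by
  rw [← hX.mulVec_of_matched h]
  simp only [Matrix.mulVec, dotProduct]
  rw [Finset.sum_comm]
  exact Finset.sum_congr rfl fun j _ => by rw [← Finset.sum_mul, hX.col_sum, one_mul]

/-- Matrices that intertwine two doubly stochastic matrices preserve matched pairs. -/
theorem Matched.mulVec {Y : Matrix m' n' ℝ} (hX : IsDoublyStochastic X)
    (hY : IsDoublyStochastic Y) {M : Matrix n n' ℝ} {N : Matrix m m' ℝ}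
    (h₁ : X * M = N * Y) (h₂ : M * Y.transpose = X.transpose * N) {f : n' → ℝ} {g : m' → ℝ}
    (h : Matched Y f g) : Matched X (M.mulVec f) (N.mulVec g) := by
  refine hX.matched_of_mulVec ?_ ?_
  · rw [Matrix.mulVec_mulVec, h₁, ← Matrix.mulVec_mulVec, hY.mulVec_of_matched h]
  · rw [Matrix.mulVec_mulVec, ← h₂, ← Matrix.mulVec_mulVec,
      hY.transpose.mulVec_of_matched h.transpose]

open scoped Classical in
theorem IsDoublyStochastic.card_fibre_eq_of_matched {γ : Type*} (hX : IsDoublyStochastic X)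
    {f : n → γ} {g : m → γ} (h : Matched X f g) (c : γ) :
    (Finset.univ.filter fun j => f j = c).card = (Finset.univ.filter fun i => g i = c).card := by
  have := hX.sum_eq_of_matched (h.indicator c)
  simpa [Finset.sum_boole] using this

end DoublyStochastic

/-- Used to split a degree-preserving bijection into its element and constraint parts. -/
theorem exists_equiv_inl {α β α' β' : Type*} (e : α ⊕ β ≃ α' ⊕ β')
    (h : ∀ x, (e x).isLeft = x.isLeft) : ∃ e₁ : α ≃ α', ∀ a, Sum.inl (e₁ a) = e (.inl a) := by
  refine ⟨Equiv.sumIsLeft.symm.trans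
    ((e.subtypeEquiv fun x => by rw [h]).trans Equiv.sumIsLeft), fun a => ?_⟩
  simp [Equiv.sumIsLeft]

theorem exists_equiv_inr {α β α' β' : Type*} (e : α ⊕ β ≃ α' ⊕ β')
    (h : ∀ x, (e x).isLeft = x.isLeft) : ∃ e₁ : β ≃ β', ∀ a, Sum.inr (e₁ a) = e (.inr a) := by
  refine ⟨Equiv.sumIsRight.symm.trans
    ((e.subtypeEquiv fun x => by rw [← Sum.not_isLeft, ← Sum.not_isLeft, h]).trans
      Equiv.sumIsRight), fun a => ?_⟩
  simp [Equiv.sumIsRight]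

/-! ### Iterated degrees: 1 → 2 and 2 → 3. -/

section IteratedDegree

variable {σ : FirstOrder.Language.{u, v}}

open scoped Classical in
-- With `f` an iterated degree, the right side is the multiplicity of `(ℓ, c)` in the next degree of
-- `C`; this makes the refinement step linear algebra.
theorem incMatrix_transpose_mulVec_indicator (A : Type w) [σ.Structure A] [Fintype A] {γ : Type*}
    (f : A → γ) (ℓ : Label σ) (c : γ) (C : Constraint σ A) :
    (incMatrix σ A ℓ).transpose.mulVec (fun a => if f a = c then (1 : ℝ) else 0) C =
      ((Finset.univ.filter fun a => (labelMatrix σ A a C, f a) = (ℓ, c)).card : ℝ) := by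
  simp [Matrix.mulVec, dotProduct, incMatrix, ← ite_and, Prod.ext_iff, and_comm]

theorem Constraint.arity_pos [IsEmpty (σ.Relations 0)] {A : Type*} [σ.Structure A]
    (C : Constraint σ A) : 0 < C.sym.1 := by
  obtain ⟨⟨n, R⟩, t, ht⟩ := C
  cases n with
  | zero => exact (IsEmpty.false R).elim
  | succ n => exact Nat.succ_pos n

variable [Finite (RelSymbol σ)]

theorem iterDegree_succ_inl (A : Type w) [σ.Structure A] [Fintype A] (k : ℕ) (a : A) :
    iterDegree σ A (k + 1) (.inl a) = (Finset.univ : Finset (Constraint σ A)).val.map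
      fun c => (labelMatrix σ A a c, iterDegree σ A k (.inr c)) := rfl

theorem iterDegree_succ_inr (A : Type w) [σ.Structure A] [Fintype A] (k : ℕ)
    (c : Constraint σ A) :
    iterDegree σ A (k + 1) (.inr c) = (Finset.univ : Finset A).val.map
      fun a => (labelMatrix σ A a c, iterDegree σ A k (.inl a)) := rfl

open scoped Classical in
theorem incMatrix_mulVec_indicator (A : Type w) [σ.Structure A] [Fintype A] {γ : Type*}
    (f : Constraint σ A → γ) (ℓ : Label σ) (c : γ) (a : A) :
    (incMatrix σ A ℓ).mulVec (fun C => if f C = c then (1 : ℝ) else 0) a =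
      ((Finset.univ.filter fun C => (labelMatrix σ A a C, f C) = (ℓ, c)).card : ℝ) := by
  simp [Matrix.mulVec, dotProduct, incMatrix, ← ite_and, Prod.ext_iff, and_comm]

variable {A B : Type*} [σ.Structure A] [σ.Structure B] [Fintype A] [Fintype B]

theorem matched_iterDegree {X : Matrix B A ℝ} {Y : Matrix (Constraint σ B) (Constraint σ A) ℝ}
    (hX : IsDoublyStochastic X) (hY : IsDoublyStochastic Y)
    (h : ∀ ℓ : Label σ, X * incMatrix σ A ℓ = incMatrix σ B ℓ * Y ∧
      incMatrix σ A ℓ * Y.transpose = X.transpose * incMatrix σ B ℓ) (k : ℕ) :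
    Matched X (fun a => iterDegree σ A k (.inl a)) (fun b => iterDegree σ B k (.inl b)) ∧
    Matched Y (fun a => iterDegree σ A k (.inr a)) (fun b => iterDegree σ B k (.inr b)) := by
  classical
  induction k with
  | zero => exact ⟨fun _ _ _ => rfl, fun _ _ _ => rfl⟩
  | succ k ih =>
    constructor
    · intro b a hab
      simp only [iterDegree_succ_inl]
      have : ∀ p, (Finset.univ.filter fun D =>
          (labelMatrix σ B b D, iterDegree σ B k (.inr D)) = p).card =
          (Finset.univ.filter fun C =>
            (labelMatrix σ A a C, iterDegree σ A k (.inr C)) = p).card := by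
        rintro ⟨ℓ, d⟩
        have := (ih.2.indicator d).mulVec hX hY (h ℓ).1 (h ℓ).2 b a hab
        rw [incMatrix_mulVec_indicator, incMatrix_mulVec_indicator] at this
        convert Nat.cast_injective (R := ℝ) this
      obtain ⟨e, he⟩ := exists_equiv_of_card_fibres this
      exact map_univ_eq_of_equiv e he
    · intro D C hDC
      simp only [iterDegree_succ_inr]
      have : ∀ p, (Finset.univ.filter fun b =>
          (labelMatrix σ B b D, iterDegree σ B k (.inl b)) = p).card =
          (Finset.univ.filter fun a =>
            (labelMatrix σ A a C, iterDegree σ A k (.inl a)) = p).card := by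
        rintro ⟨ℓ, d⟩
        -- For constraints the equations are transposed and `X`, `Y` exchange roles.
        have := (ih.1.indicator d).mulVec (M := (incMatrix σ A ℓ).transpose)
          (N := (incMatrix σ B ℓ).transpose) hY hX
          (by simpa using (congrArg Matrix.transpose (h ℓ).2))
          (by simpa using (congrArg Matrix.transpose (h ℓ).1)) D C hDC
        rw [incMatrix_transpose_mulVec_indicator, incMatrix_transpose_mulVec_indicator] at this
        convert Nat.cast_injective (R := ℝ) this
      obtain ⟨e, he⟩ := exists_equiv_of_card_fibres this
      exact map_univ_eq_of_equiv e he

theorem MatrixCondition.sameIterDegree (h : MatrixCondition σ A B) : SameIterDegree σ A B := by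
  classical
  obtain ⟨X, Y, hX, hY, h⟩ := h
  intro k
  obtain ⟨h1, h2⟩ := matched_iterDegree hX hY h k
  obtain ⟨e, he⟩ := exists_equiv_of_card_fibres (hX.card_fibre_eq_of_matched h1)
  obtain ⟨e', he'⟩ := exists_equiv_of_card_fibres (hY.card_fibre_eq_of_matched h2)
  refine map_univ_eq_of_equiv (Equiv.sumCongr e e') ?_
  rintro (a | C)
  · exact he a
  · exact he' C

/-- Positive arity gives an element to look at: equal degrees of `a` and `D` at level `k + 1` would
match an entry of `D` with a constraint of `A` at level `k`. This swaps the two structures, so both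
statements are proved together. -/
theorem iterDegree_inl_ne_inr_and [IsEmpty (σ.Relations 0)] (k : ℕ) :
    (∀ (a : A) (D : Constraint σ B), iterDegree σ A k (.inl a) ≠ iterDegree σ B k (.inr D)) ∧
    ∀ (b : B) (C : Constraint σ A), iterDegree σ B k (.inl b) ≠ iterDegree σ A k (.inr C) := by
  induction k with
  | zero =>
    exact ⟨fun a D h => Bool.noConfusion (congrArg ULift.down h),
      fun a D h => Bool.noConfusion (congrArg ULift.down h)⟩
  | succ k ih =>
    refine ⟨fun a D h => ?_, fun b C h => ?_⟩
    · rw [iterDegree_succ_inl, iterDegree_succ_inr] at h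
      obtain ⟨e, he⟩ := exists_equiv_of_map_univ_eq h
      exact ih.2 _ _ (congrArg Prod.snd (he (e.symm (D.tuple ⟨0, D.arity_pos⟩))))
    · rw [iterDegree_succ_inl, iterDegree_succ_inr] at h
      obtain ⟨e, he⟩ := exists_equiv_of_map_univ_eq h
      exact ih.1 _ _ (congrArg Prod.snd (he (e.symm (C.tuple ⟨0, C.arity_pos⟩))))

/-- Iterated degrees distinguish elements from constraints. -/
theorem isLeft_eq_of_iterDegree_eq [IsEmpty (σ.Relations 0)] {k : ℕ} {x : A ⊕ Constraint σ A}
    {y : B ⊕ Constraint σ B} (h : iterDegree σ A k x = iterDegree σ B k y) :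
    x.isLeft = y.isLeft := by
  obtain ⟨h1, h2⟩ := iterDegree_inl_ne_inr_and (σ := σ) (A := A) (B := B) k
  rcases x with a | C <;> rcases y with b | D
  · rfl
  · exact (h1 _ _ h).elim
  · exact (h2 _ _ h.symm).elim
  · rfl

/-- A bijection that matches the entries of two multisets at one level also matches them one level
lower, by induction; at level `0` only the sort of `x` and `y` matters. -/
theorem iterDegree_eq_of_succ [IsEmpty (σ.Relations 0)] {k : ℕ} {x : A ⊕ Constraint σ A}
    {y : B ⊕ Constraint σ B} (h : iterDegree σ A (k + 1) x = iterDegree σ B (k + 1) y) :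
    iterDegree σ A k x = iterDegree σ B k y := by
  induction k generalizing x y with
  | zero =>
    have := isLeft_eq_of_iterDegree_eq h
    rcases x with a | C <;> rcases y with b | D <;> first | rfl | simp at this
  | succ k ih =>
    have := isLeft_eq_of_iterDegree_eq h
    rcases x with a | C <;> rcases y with b | D
    · rw [iterDegree_succ_inl, iterDegree_succ_inl] at h
      obtain ⟨e, he⟩ := exists_equiv_of_map_univ_eq h
      rw [iterDegree_succ_inl, iterDegree_succ_inl]
      exact map_univ_eq_of_equiv e fun C =>
        Prod.ext (Prod.mk.inj (he C)).1 (ih (Prod.mk.inj (he C)).2.symm).symm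
    · simp at this
    · simp at this
    · rw [iterDegree_succ_inr, iterDegree_succ_inr] at h
      obtain ⟨e, he⟩ := exists_equiv_of_map_univ_eq h
      rw [iterDegree_succ_inr, iterDegree_succ_inr]
      exact map_univ_eq_of_equiv e fun C =>
        Prod.ext (Prod.mk.inj (he C)).1 (ih (Prod.mk.inj (he C)).2.symm).symm

/-- The pairs with equal `k`-th degrees form a decreasing chain of subsets of a finite set. -/
theorem exists_stable_iterDegree [IsEmpty (σ.Relations 0)] (A B : Type*) [σ.Structure A]
    [σ.Structure B] [Fintype A] [Fintype B] :
    ∃ k, ∀ (x : A ⊕ Constraint σ A) (y : B ⊕ Constraint σ B),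
      iterDegree σ A k x = iterDegree σ B k y →
        iterDegree σ A (k + 1) x = iterDegree σ B (k + 1) y := by
  let S : ℕ → Set ((A ⊕ Constraint σ A) × (B ⊕ Constraint σ B)) := fun k =>
    {z | iterDegree σ A k z.1 = iterDegree σ B k z.2}
  have hS : Antitone S := antitone_nat_of_succ_le fun k z hz => iterDegree_eq_of_succ hz
  obtain ⟨k, hk⟩ := WellFoundedGT.monotone_chain_condition (α := (Set _)ᵒᵈ) ⟨S, hS⟩
  refine ⟨k, fun x y h => ?_⟩
  have : S k = S (k + 1) := hk (k + 1) (Nat.le_succ k)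
  have hm : (x, y) ∈ S k := h
  rw [this] at hm
  exact hm

/-- At a stable level `k`, the degree of level `k` determines that of level `k + 1`, which records
the parameters of the partition. -/
theorem SameIterDegree.haveCommonEquitablePartition [IsEmpty (σ.Relations 0)]
    (h : SameIterDegree σ A B) : HaveCommonEquitablePartition σ A B := by
  classical
  obtain ⟨k, hk⟩ := exists_stable_iterDegree (σ := σ) A B
  obtain ⟨e, he⟩ := exists_equiv_of_map_univ_eq (h k)
  have hl : ∀ x, (e x).isLeft = x.isLeft := fun x => isLeft_eq_of_iterDegree_eq (he x)
  refine haveCommonEquitablePartition_of_colouring (fun a => iterDegree σ A k (.inl a))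
    (fun b => iterDegree σ B k (.inl b)) (fun a => iterDegree σ A k (.inr a))
    (fun b => iterDegree σ B k (.inr b)) ?_ ?_ ?_ ?_
  · obtain ⟨e₁, he₁⟩ := exists_equiv_inl e hl
    exact fun i => card_filter_eq_of_equiv e₁ fun a => by rw [he₁, he]
  · obtain ⟨e₁, he₁⟩ := exists_equiv_inr e hl
    exact fun i => card_filter_eq_of_equiv e₁ fun a => by rw [he₁, he]
  · intro a b hab j ℓ
    have := hk _ _ hab
    rw [iterDegree_succ_inl, iterDegree_succ_inl] at this
    obtain ⟨e, he⟩ := exists_equiv_of_map_univ_eq this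
    refine card_filter_eq_of_equiv e fun C => ?_
    have := he C
    rw [Prod.mk.injEq] at this
    rw [this.1, this.2]
  · intro a b hab j ℓ
    have := hk _ _ hab
    rw [iterDegree_succ_inr, iterDegree_succ_inr] at this
    obtain ⟨e, he⟩ := exists_equiv_of_map_univ_eq this
    refine card_filter_eq_of_equiv e fun C => ?_
    have := he C
    rw [Prod.mk.injEq] at this
    rw [this.1, this.2]

end IteratedDegree

/-! ### Block-uniform doubly stochastic matrices. -/

section UniformMatrix

open scoped Classical in
/-- The matrix that is uniform on each pair of corresponding classes of two colourings. -/
noncomputable def uniformMatrix {A B I : Type*} [Fintype A] (p : A → I) (q : B → I) :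
    Matrix B A ℝ :=
  fun b a => if q b = p a then ((Finset.univ.filter fun a' => p a' = p a).card : ℝ)⁻¹ else 0

variable {A B I : Type*} [Fintype A] {p : A → I} {q : B → I}

open scoped Classical in
-- Row `b` averages over the class of colour `q b`. If that class is empty, both sides are `0`, the
-- right one because `0 / 0 = 0`.
theorem sum_uniformMatrix_mul (b : B) (P : A → Prop) [DecidablePred P] :
    ∑ a, uniformMatrix p q b a * (if P a then 1 else 0) =
      ((Finset.univ.filter fun a => p a = q b ∧ P a).card : ℝ) /
        ((Finset.univ.filter fun a => p a = q b).card : ℝ) := by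
  rw [div_eq_mul_inv, Finset.card_filter, Nat.cast_sum, Finset.sum_mul]
  refine Finset.sum_congr rfl fun a _ => ?_
  unfold uniformMatrix
  by_cases h : q b = p a
  · by_cases h' : P a <;> simp [h, h']
  · simp [h, Ne.symm h]

variable [Fintype B]

open scoped Classical in
theorem uniformMatrix_transpose
    (h : ∀ i, (Finset.univ.filter fun a => p a = i).card =
      (Finset.univ.filter fun b => q b = i).card) (a : A) (b : B) :
    uniformMatrix p q b a = uniformMatrix q p a b := by
  unfold uniformMatrix
  by_cases hab : q b = p a
  · rw [if_pos hab, if_pos hab.symm, h, hab]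
  · rw [if_neg hab, if_neg (Ne.symm hab)]

open scoped Classical in
theorem uniformMatrix_row_sum
    (h : ∀ i, (Finset.univ.filter fun a => p a = i).card =
      (Finset.univ.filter fun b => q b = i).card) (b : B) :
    ∑ a, uniformMatrix p q b a = 1 := by
  have := sum_uniformMatrix_mul (p := p) (q := q) b (fun _ => True)
  simp only [if_true, mul_one, and_true] at this
  rw [this, div_self]
  rw [h, Nat.cast_ne_zero]
  exact (Finset.card_pos.2 ⟨b, by simp⟩).ne'

open scoped Classical in
theorem uniformMatrix_isDoublyStochastic
    (h : ∀ i, (Finset.univ.filter fun a => p a = i).card =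
      (Finset.univ.filter fun b => q b = i).card) :
    IsDoublyStochastic (uniformMatrix p q) := by
  refine ⟨?_, fun b a => ?_, uniformMatrix_row_sum h, fun a => ?_⟩
  · obtain ⟨e, -⟩ := exists_equiv_of_card_fibres h
    exact (Fintype.card_congr e).symm
  · unfold uniformMatrix
    split_ifs
    · positivity
    · exact le_rfl
  · simp only [uniformMatrix_transpose h]
    exact uniformMatrix_row_sum (fun i => (h i).symm) a

end UniformMatrix

/-! ### Matrices from an equitable partition (3 → 1) and for graphs (1 → 5). -/

section MatrixCondition

variable {σ : FirstOrder.Language.{u, v}}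

theorem labelMatrix_mk_eq_iff {A : Type*} [σ.Structure A] [DecidableEq A] (a : A)
    (R : RelSymbol σ) (t : Fin R.1 → A)
    (ht : FirstOrder.Language.Structure.RelMap R.2 t) (S : Finset (Fin R.1)) :
    labelMatrix σ A a ⟨R, t, ht⟩ = ⟨R, S⟩ ↔ (Finset.univ.filter fun i => a = t i) = S := by
  unfold labelMatrix
  rw [Sigma.mk.injEq]
  simp only [heq_eq_eq, true_and]

variable [Finite (RelSymbol σ)]
variable {A B : Type*} [σ.Structure A] [σ.Structure B] [Fintype A] [Fintype B]

open scoped Classical in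
-- Count in two ways the pairs in `P_i × Q_j` with label `ℓ`.
theorem IsEquitable.card_mul_card {I J : Type} {p : A → I} {q : Constraint σ A → J}
    {c : I → J → Label σ → ℕ} {d : J → I → Label σ → ℕ} (h : IsEquitable σ A p q c d)
    (i : I) (j : J) (ℓ : Label σ) :
    (Finset.univ.filter fun a => p a = i).card * c i j ℓ =
      (Finset.univ.filter fun C => q C = j).card * d j i ℓ := by
  have := Finset.sum_card_bipartiteAbove_eq_sum_card_bipartiteBelow
    (s := Finset.univ.filter fun a => p a = i) (t := Finset.univ.filter fun C => q C = j)
    (fun a C => labelMatrix σ A a C = ℓ)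
  simp only [Finset.bipartiteAbove, Finset.bipartiteBelow, Finset.filter_filter] at this
  rw [Finset.sum_congr rfl (g := fun _ => c i j ℓ),
    Finset.sum_congr rfl (s₁ := Finset.filter (fun C => q C = j) _) (g := fun _ => d j i ℓ)] at this
  · simpa using this
  · intro C hC
    rw [h.card_elements, (Finset.mem_filter.1 hC).2]
  · intro a ha
    rw [h.card_constraints, (Finset.mem_filter.1 ha).2]

theorem HaveCommonEquitablePartition.matrixCondition (h : HaveCommonEquitablePartition σ A B) :
    MatrixCondition σ A B := by
  classical
  obtain ⟨I, J, pA, qA, pB, qB, c, d, hA, hB, hp, hq⟩ := h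
  have hp' : ∀ i, (Finset.univ.filter fun a => pA a = i).card =
      (Finset.univ.filter fun b => pB b = i).card := by convert hp
  have hq' : ∀ i, (Finset.univ.filter fun a => qA a = i).card =
      (Finset.univ.filter fun b => qB b = i).card := by convert hq
  -- With `i` the class of `b` and `j` that of `C`, the two sides are the entries at `(b, C)` of `X
  -- M_A^ℓ` and of `M_B^ℓ Y`.
  have key : ∀ i j ℓ, (d j i ℓ : ℝ) / ((Finset.univ.filter fun a => pA a = i).card : ℝ) =
      (c i j ℓ : ℝ) / ((Finset.univ.filter fun C => qB C = j).card : ℝ) := by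
    intro i j ℓ
    obtain ⟨a, ha⟩ := hA.surj_p i
    obtain ⟨C, hC⟩ := hA.surj_q j
    have h1 : ((Finset.univ.filter fun a => pA a = i).card : ℝ) ≠ 0 := by
      rw [Nat.cast_ne_zero]
      exact (Finset.card_pos.2 ⟨a, by simp [ha]⟩).ne'
    have h2 : ((Finset.univ.filter fun a => qA a = j).card : ℝ) ≠ 0 := by
      rw [Nat.cast_ne_zero]
      exact (Finset.card_pos.2 ⟨C, by simp [hC]⟩).ne'
    rw [← hq', div_eq_div_iff h1 h2]
    have := hA.card_mul_card i j ℓ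
    have h3 := congrArg (Nat.cast (R := ℝ)) this
    push_cast at h3
    convert h3.symm using 1
    · rw [mul_comm]
    · rw [mul_comm]
  refine ⟨uniformMatrix pA pB, uniformMatrix qA qB, uniformMatrix_isDoublyStochastic hp',
    uniformMatrix_isDoublyStochastic hq', fun ℓ => ⟨?_, ?_⟩⟩
  · ext b C
    simp only [Matrix.mul_apply, incMatrix]
    rw [sum_uniformMatrix_mul b (fun a => labelMatrix σ A a C = ℓ)]
    simp only [uniformMatrix_transpose hq', mul_comm (ite _ _ _)]
    rw [sum_uniformMatrix_mul C (fun D => labelMatrix σ B b D = ℓ)]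
    have e1 := hA.card_elements C (pB b) ℓ
    have e2 := hB.card_constraints b (qA C) ℓ
    have := key (pB b) (qA C) ℓ
    rw [← e1, ← e2] at this
    convert this
  · ext a D
    simp only [Matrix.mul_apply, incMatrix, Matrix.transpose_apply, mul_comm (ite _ _ _)]
    rw [sum_uniformMatrix_mul D (fun C => labelMatrix σ A a C = ℓ)]
    simp only [uniformMatrix_transpose hp']
    rw [sum_uniformMatrix_mul a (fun b => labelMatrix σ B b D = ℓ)]
    have e1 := hB.card_elements D (pA a) ℓ
    have e2 := hA.card_constraints a (qB D) ℓ
    have := key (pA a) (qB D) ℓ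
    rw [← e1, ← e2, hp', ← hq'] at this
    convert this.symm

/-- An edge is the unique constraint with `a` in position `0` and `a'` in position `1`;
irreflexivity ensures that the labels are exactly `{0}` and `{1}`. -/
theorem IsGraph.adjMatrix_eq {E : σ.Relations 2} (h : IsGraph σ E A) :
    adjMatrix σ E A = incMatrix σ A ⟨⟨2, E⟩, {0}⟩ * (incMatrix σ A ⟨⟨2, E⟩, {1}⟩).transpose := by
  classical
  have key : ∀ a a' C, (labelMatrix σ A a C = ⟨⟨2, E⟩, {0}⟩ ∧
      labelMatrix σ A a' C = ⟨⟨2, E⟩, {1}⟩) ↔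
        ∃ hE : FirstOrder.Language.Structure.RelMap E ![a, a'], C = ⟨⟨2, E⟩, ![a, a'], hE⟩ := by
    rintro a a' ⟨R, t, ht⟩
    obtain rfl := h.only_symbol R
    rw [labelMatrix_mk_eq_iff, labelMatrix_mk_eq_iff]
    constructor
    · rintro ⟨h1, h2⟩
      have e1 : a = t 0 := by
        have : (0 : Fin 2) ∈ Finset.univ.filter fun i => a = t i := by rw [h1]; simp
        simpa using this
      have e2 : a' = t 1 := by
        have : (1 : Fin 2) ∈ Finset.univ.filter fun i => a' = t i := by rw [h2]; simp
        simpa using this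
      have : t = ![a, a'] := by
        funext i
        fin_cases i
        · exact e1.symm
        · exact e2.symm
      subst this
      exact ⟨ht, rfl⟩
    · rintro ⟨hE, hC⟩
      have : t = ![a, a'] := by simpa using hC
      subst this
      have hne : a ≠ a' := fun h' => h.irrefl a (by simpa [← h'] using hE)
      constructor <;> ext i <;> fin_cases i <;> simp [hne, hne.symm]
  ext a a'
  simp only [adjMatrix, Matrix.mul_apply, Matrix.transpose_apply, incMatrix, ← ite_and,
    mul_ite, mul_one, mul_zero, and_comm, key]
  split_ifs with hE
  · simp [hE]
  · simp [hE]

/-- Push `X` through the first incidence factor, where it becomes `Y`, and back through the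
transposed second one. -/
theorem MatrixCondition.adjCondition {E : σ.Relations 2} (hA : IsGraph σ E A)
    (hB : IsGraph σ E B) (h : MatrixCondition σ A B) : AdjCondition σ E A B := by
  obtain ⟨X, Y, hX, -, h⟩ := h
  refine ⟨X, hX, ?_⟩
  have h2 := congrArg Matrix.transpose (h ⟨⟨2, E⟩, {1}⟩).2
  simp only [Matrix.transpose_mul, Matrix.transpose_transpose] at h2
  rw [hA.adjMatrix_eq, hB.adjMatrix_eq, ← Matrix.mul_assoc, (h _).1, Matrix.mul_assoc, h2,
    Matrix.mul_assoc]

end MatrixCondition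

/-! ### Extending a colouring of elements to constraints. -/

section ElementColouring

variable {σ : FirstOrder.Language.{u, v}}

/-- The colour of a constraint induced by a colouring of the elements: its symbol, the equality
pattern of its tuple, and the colours of the entries. -/
def constraintColour {A I : Type*} [σ.Structure A] (p : A → I) (C : Constraint σ A) :
    Σ R : RelSymbol σ, Setoid (Fin R.1) × (Fin R.1 → I) :=
  ⟨C.sym, Setoid.ker C.tuple, p ∘ C.tuple⟩

theorem constraintColour_mk_eq_iff {A I : Type*} [σ.Structure A] (p : A → I) (R : RelSymbol σ)
    (t : Fin R.1 → A) (ht : FirstOrder.Language.Structure.RelMap R.2 t) (π : Setoid (Fin R.1))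
    (v : Fin R.1 → I) :
    constraintColour p ⟨R, t, ht⟩ = ⟨R, π, v⟩ ↔ Setoid.ker t = π ∧ p ∘ t = v := by
  unfold constraintColour
  rw [Sigma.mk.injEq]
  simp only [heq_eq_eq, true_and, Prod.mk.injEq]

open scoped Classical in
/-- The number of tuples of `R` with entry `a` at position `i`, equality pattern `π` and
entries of colours `v`. -/
noncomputable def patternCount {A I : Type*} [σ.Structure A] [Fintype A] (p : A → I)
    (R : RelSymbol σ) (i : Fin R.1) (π : Setoid (Fin R.1)) (v : Fin R.1 → I) (a : A) : ℕ :=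
  (Finset.univ.filter fun t : Fin R.1 → A => FirstOrder.Language.Structure.RelMap R.2 t ∧
    (Setoid.ker t = π ∧ p ∘ t = v) ∧ t i = a).card

open scoped Classical in
-- A label with `k ∈ S` can only be carried by the entry `t k`, and only if `S` is the block of `k`
-- in the equality pattern.
theorem card_element_label_eq {A I : Type*} [σ.Structure A] [Fintype A] (p : A → I)
    (R : RelSymbol σ) (t : Fin R.1 → A) (ht : FirstOrder.Language.Structure.RelMap R.2 t)
    (i : I) (S : Finset (Fin R.1)) {k : Fin R.1} (hk : k ∈ S) :
    (Finset.univ.filter fun a => p a = i ∧ labelMatrix σ A a ⟨R, t, ht⟩ = ⟨R, S⟩).card =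
      if S = Finset.univ.filter (fun j => Setoid.ker t k j) ∧ (p ∘ t) k = i then 1 else 0 := by
  simp only [labelMatrix_mk_eq_iff]
  have key : ∀ a, (Finset.univ.filter fun j => a = t j) = S ↔
        S = Finset.univ.filter (fun j => Setoid.ker t k j) ∧ a = t k := by
    intro a
    constructor
    · rintro rfl
      simp only [Finset.mem_filter, Finset.mem_univ, true_and] at hk
      exact ⟨by simp [Setoid.ker_def, hk], hk⟩
    · rintro ⟨hS, rfl⟩
      rw [hS]
      simp [Setoid.ker_def]
  simp only [key]
  split_ifs with hS
  · rw [Finset.card_eq_one]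
    refine ⟨t k, ?_⟩
    ext a
    simp only [Finset.mem_filter, Finset.mem_univ, true_and, Finset.mem_singleton]
    exact ⟨fun h => h.2.2, by rintro rfl; exact ⟨hS.2, hS.1, rfl⟩⟩
  · rw [Finset.card_eq_zero, Finset.filter_eq_empty_iff]
    rintro a - ⟨h1, h2, rfl⟩
    exact hS ⟨h2, h1⟩

variable [Finite (RelSymbol σ)]

open scoped Classical in
-- Sort the tuples by their entry at position `i`.
theorem card_constraintColour_eq {A I : Type*} [σ.Structure A] [Fintype A] (p : A → I)
    (R : RelSymbol σ) (i : Fin R.1) (π : Setoid (Fin R.1)) (v : Fin R.1 → I) :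
    (Finset.univ.filter fun C : Constraint σ A => constraintColour p C = ⟨R, π, v⟩).card =
      ∑ a, patternCount p R i π v a := by
  have h1 : (Finset.univ.filter fun t : Fin R.1 → A =>
      FirstOrder.Language.Structure.RelMap R.2 t ∧ Setoid.ker t = π ∧ p ∘ t = v).card =
      (Finset.univ.filter fun C : Constraint σ A => constraintColour p C = ⟨R, π, v⟩).card := by
    refine Finset.card_bij (fun t ht => ⟨R, t, (Finset.mem_filter.1 ht).2.1⟩) ?_ ?_ ?_
    · intro t ht
      simp only [Finset.mem_filter, Finset.mem_univ, true_and] at ht ⊢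
      rw [constraintColour_mk_eq_iff]
      exact ht.2
    · intro t ht s hs hts
      simpa using hts
    · rintro ⟨R', t, ht⟩ hC
      simp only [Finset.mem_filter, Finset.mem_univ, true_and] at hC
      obtain rfl : R' = R := congrArg Sigma.fst hC
      rw [constraintColour_mk_eq_iff] at hC
      exact ⟨t, by simpa using ⟨ht, hC⟩, rfl⟩
  rw [← h1, Finset.card_eq_sum_card_fiberwise (t := Finset.univ) (f := fun t => t i) (by simp)]
  refine Finset.sum_congr rfl fun a _ => ?_
  rw [patternCount, Finset.filter_filter]
  simp only [and_assoc]

open scoped Classical in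
-- As `i ∈ S`, the label says that entry `i` is `a` and that `S` is the block of `i`.
theorem card_constraintColour_label_eq {A I : Type*} [σ.Structure A] [Fintype A] (p : A → I)
    (R : RelSymbol σ) (i : Fin R.1) (π : Setoid (Fin R.1)) (v : Fin R.1 → I) (a : A)
    (S : Finset (Fin R.1)) (hi : i ∈ S) :
    (Finset.univ.filter fun C : Constraint σ A => constraintColour p C = ⟨R, π, v⟩ ∧
      labelMatrix σ A a C = ⟨R, S⟩).card =
      if S = Finset.univ.filter (fun j => π i j) then patternCount p R i π v a else 0 := by
  have key : ∀ t : Fin R.1 → A, Setoid.ker t = π →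
      ((Finset.univ.filter fun j => a = t j) = S ↔
        S = Finset.univ.filter (fun j => π i j) ∧ t i = a) := by
    rintro t rfl
    constructor
    · rintro rfl
      simp only [Finset.mem_filter, Finset.mem_univ, true_and] at hi
      exact ⟨by simp [Setoid.ker_def, hi], hi.symm⟩
    · rintro ⟨hS, rfl⟩
      rw [hS]
      simp [Setoid.ker_def]
  split_ifs with hS
  · symm
    refine Finset.card_bij (fun t ht => ⟨R, t, (Finset.mem_filter.1 ht).2.1⟩) ?_ ?_ ?_
    · intro t ht
      simp only [Finset.mem_filter, Finset.mem_univ, true_and] at ht ⊢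
      rw [constraintColour_mk_eq_iff, labelMatrix_mk_eq_iff, key t ht.2.1.1]
      exact ⟨ht.2.1, hS, ht.2.2⟩
    · intro t ht s hs hts
      simpa using hts
    · rintro ⟨R', t, ht⟩ hC
      simp only [Finset.mem_filter, Finset.mem_univ, true_and] at hC
      obtain rfl : R' = R := congrArg Sigma.fst hC.1
      rw [constraintColour_mk_eq_iff, labelMatrix_mk_eq_iff] at hC
      rw [key t hC.1.1] at hC
      exact ⟨t, by simpa using ⟨ht, hC.1, hC.2.2⟩, rfl⟩
  · rw [Finset.card_eq_zero, Finset.filter_eq_empty_iff]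
    rintro ⟨R', t, ht⟩ - hC
    obtain rfl : R' = R := congrArg Sigma.fst hC.1
    rw [constraintColour_mk_eq_iff, labelMatrix_mk_eq_iff] at hC
    rw [key t hC.1.1] at hC
    exact hS hC.2.1

variable {A B : Type*} [σ.Structure A] [σ.Structure B] [Fintype A] [Fintype B]

open scoped Classical in
/-- A colouring of the elements for which the numbers of tuples of a given pattern through an
element depend only on the colour of the element extends to a common equitable partition. -/
theorem haveCommonEquitablePartition_of_patternCount [IsEmpty (σ.Relations 0)] {I : Type*}
    (pA : A → I) (pB : B → I)
    (hp : ∀ i, (Finset.univ.filter fun a => pA a = i).card =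
      (Finset.univ.filter fun b => pB b = i).card)
    (h : ∀ a b, pA a = pB b → ∀ (R : RelSymbol σ) (i : Fin R.1) (π : Setoid (Fin R.1))
      (v : Fin R.1 → I), patternCount pA R i π v a = patternCount pB R i π v b) :
    HaveCommonEquitablePartition σ A B := by
  have hpos : ∀ R : RelSymbol σ, 0 < R.1 := by
    rintro ⟨n, R⟩
    cases n with
    | zero => exact (IsEmpty.false R).elim
    | succ n => exact Nat.succ_pos n
  have hlab : Finite (Label σ) := inferInstance
  have := Fintype.ofFinite (Label σ)
  have hq : ∀ j, (Finset.univ.filter fun C => constraintColour pA C = j).card =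
      (Finset.univ.filter fun D : Constraint σ B => constraintColour pB D = j).card := by
    rintro ⟨R, π, v⟩
    rw [card_constraintColour_eq pA R ⟨0, hpos R⟩, card_constraintColour_eq pB R ⟨0, hpos R⟩]
    obtain ⟨e, he⟩ := exists_equiv_of_card_fibres hp
    exact Fintype.sum_equiv e _ _ fun a => h a (e a) (he a).symm _ _ _ _
  refine haveCommonEquitablePartition_of_colouring pA pB (constraintColour pA)
    (constraintColour pB) hp (by convert hq) ?_ ?_
  · rintro a b hab ⟨R, π, v⟩ ℓ
    -- Pattern counts control only labels with nonempty `S`. The label `(R, ∅)`, where `a` does not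
    -- occur, is what remains of the class, whose total size is known.
    have := card_fibre_eq_of_forall_ne (hq ⟨R, π, v⟩) (f := fun C => labelMatrix σ A a C)
      (g := fun D => labelMatrix σ B b D) ⟨R, ∅⟩ (c := ℓ) ?_
    · simp only [Finset.filter_filter] at this
      convert this
    rintro ⟨R', S⟩ hS
    simp only [Finset.filter_filter]
    by_cases hR : R' = R
    · subst hR
      obtain ⟨i, hi⟩ : S.Nonempty := by
        rw [Finset.nonempty_iff_ne_empty]
        rintro rfl
        exact hS rfl
      rw [card_constraintColour_label_eq pA R' i π v a S hi,
        card_constraintColour_label_eq pB R' i π v b S hi, h a b hab]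
    · rw [Finset.filter_false_of_mem, Finset.filter_false_of_mem]
      · rfl
      · rintro C - ⟨h1, h2⟩
        exact hR ((congrArg Sigma.fst h2).symm.trans (congrArg Sigma.fst h1))
      · rintro C - ⟨h1, h2⟩
        exact hR ((congrArg Sigma.fst h2).symm.trans (congrArg Sigma.fst h1))
  · rintro ⟨R, t, ht⟩ ⟨R', s, hs⟩ hCD i ℓ
    obtain rfl : R = R' := congrArg Sigma.fst hCD
    have hts := (constraintColour_mk_eq_iff pA R t ht (Setoid.ker s) (pB ∘ s)).1 hCD
    -- Again the empty label is obtained as the complement.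
    have := card_fibre_eq_of_forall_ne (hp i) (f := fun a => labelMatrix σ A a ⟨R, t, ht⟩)
      (g := fun b => labelMatrix σ B b ⟨R, s, hs⟩) ⟨R, ∅⟩ (c := ℓ) ?_
    · simp only [Finset.filter_filter] at this
      convert this
    rintro ⟨R', S⟩ hS
    simp only [Finset.filter_filter]
    by_cases hR : R' = R
    · subst hR
      obtain ⟨k, hk⟩ : S.Nonempty := by
        rw [Finset.nonempty_iff_ne_empty]
        rintro rfl
        exact hS rfl
      rw [card_element_label_eq pA R' t ht i S hk, card_element_label_eq pB R' s hs i S hk,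
        hts.1, hts.2]
    · rw [Finset.filter_false_of_mem, Finset.filter_false_of_mem]
      · rfl
      · rintro C - ⟨h1, h2⟩
        exact hR (congrArg Sigma.fst h2).symm
      · rintro C - ⟨h1, h2⟩
        exact hR (congrArg Sigma.fst h2).symm

end ElementColouring

/-! ### Graphs: 5 → 3. -/

section Graphs

variable {σ : FirstOrder.Language.{u, v}}

open scoped Classical in
-- Irreflexivity leaves only the discrete pattern, the tuple is determined by its other entry, and
-- by symmetry the position of `a` does not matter.
theorem IsGraph.patternCount_eq {E : σ.Relations 2} {A I : Type*} [σ.Structure A] [Fintype A]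
    (h : IsGraph σ E A) (p : A → I) (i : Fin 2) (π : Setoid (Fin 2)) (v : Fin 2 → I) (a : A) :
    patternCount p ⟨2, E⟩ i π v a = if π = ⊥ ∧ p a = v i then
      (Finset.univ.filter fun x => FirstOrder.Language.Structure.RelMap E ![a, x] ∧
        p x = v (1 - i)).card else 0 := by
  have hker : ∀ t : Fin 2 → A, FirstOrder.Language.Structure.RelMap E t → Setoid.ker t = ⊥ := by
    intro t ht
    rw [Setoid.ker_eq_bot_iff]
    have h2 : t = ![t 0, t 1] := by funext i; fin_cases i <;> rfl
    have h3 : t 0 ≠ t 1 := fun h01 => h.irrefl (t 1) (by rw [h2, h01] at ht; exact ht)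
    intro i j hij
    fin_cases i <;> fin_cases j
    · rfl
    · exact (h3 hij).elim
    · exact (h3 hij.symm).elim
    · rfl
  unfold patternCount
  split_ifs with hπ
  · obtain ⟨rfl, ha⟩ := hπ
    symm
    fin_cases i
    · refine Finset.card_bij (fun x _ => ![a, x]) ?_ ?_ ?_
      · intro x hx
        simp only [Finset.mem_filter, Finset.mem_univ, true_and] at hx ⊢
        refine ⟨hx.1, ⟨hker _ hx.1, ?_⟩, rfl⟩
        funext j
        fin_cases j
        · exact ha
        · exact hx.2
      · intro x _ y _ hxy
        exact congrFun hxy 1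
      · intro t ht
        simp only [Finset.mem_filter, Finset.mem_univ, true_and] at ht
        have h2 : ![a, t 1] = t := by funext i; fin_cases i; exacts [ht.2.2.symm, rfl]
        refine ⟨t 1, ?_, h2⟩
        simp only [Finset.mem_filter, Finset.mem_univ, true_and]
        rw [h2]
        exact ⟨ht.1, congrFun ht.2.1.2 1⟩
    · refine Finset.card_bij (fun x _ => ![x, a]) ?_ ?_ ?_
      · intro x hx
        simp only [Finset.mem_filter, Finset.mem_univ, true_and] at hx ⊢
        refine ⟨h.symm _ _ hx.1, ⟨hker _ (h.symm _ _ hx.1), ?_⟩, rfl⟩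
        funext j
        fin_cases j
        · exact hx.2
        · exact ha
      · intro x _ y _ hxy
        exact congrFun hxy 0
      · intro t ht
        simp only [Finset.mem_filter, Finset.mem_univ, true_and] at ht
        have h2 : ![t 0, a] = t := by funext i; fin_cases i; exacts [rfl, ht.2.2.symm]
        refine ⟨t 0, ?_, h2⟩
        simp only [Finset.mem_filter, Finset.mem_univ, true_and]
        exact ⟨h.symm _ _ (by rw [h2]; exact ht.1), congrFun ht.2.1.2 0⟩
  · rw [Finset.card_eq_zero, Finset.filter_eq_empty_iff]
    rintro t - ⟨ht, ⟨rfl, rfl⟩, rfl⟩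
    exact hπ ⟨hker t ht, rfl⟩

theorem IsGraph.adjMatrix_transpose {E : σ.Relations 2} {A : Type*} [σ.Structure A]
    (h : IsGraph σ E A) : (adjMatrix σ E A).transpose = adjMatrix σ E A := by
  ext a b
  simp only [adjMatrix, Matrix.transpose_apply]
  split_ifs with h₁ h₂ h₂
  · rfl
  · exact (h₂ (h.symm _ _ h₁)).elim
  · exact (h₁ (h.symm _ _ h₂)).elim
  · rfl

open scoped Classical in
theorem adjMatrix_mulVec_indicator (E : σ.Relations 2) {A γ : Type*} [σ.Structure A] [Fintype A]
    (f : A → γ) (c : γ) (a : A) :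
    (adjMatrix σ E A).mulVec (fun x => if f x = c then (1 : ℝ) else 0) a =
      ((Finset.univ.filter fun x => FirstOrder.Language.Structure.RelMap E ![a, x] ∧
        f x = c).card : ℝ) := by
  simp [Matrix.mulVec, dotProduct, adjMatrix, ← ite_and, and_comm]

variable [Finite (RelSymbol σ)] {A B : Type*} [σ.Structure A] [σ.Structure B] [Fintype A]
  [Fintype B]

theorem AdjCondition.haveCommonEquitablePartition [IsEmpty (σ.Relations 0)] {E : σ.Relations 2}
    (hA : IsGraph σ E A) (hB : IsGraph σ E B) (h : AdjCondition σ E A B) :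
    HaveCommonEquitablePartition σ A B := by
  classical
  obtain ⟨X, hX, hN⟩ := h
  have hN' : adjMatrix σ E A * X.transpose = X.transpose * adjMatrix σ E B := by
    have := congrArg Matrix.transpose hN
    rwa [Matrix.transpose_mul, Matrix.transpose_mul, hA.adjMatrix_transpose,
      hB.adjMatrix_transpose] at this
  -- Vertices are coloured by the values of all matched functions; this colouring is itself matched.
  let G := {f : A ⊕ B → ℝ // Matched X (fun a => f (.inl a)) (fun b => f (.inr b))}
  let pA : A → G → ℝ := fun a f => f.1 (.inl a)
  let pB : B → G → ℝ := fun b f => f.1 (.inr b)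
  have hm : Matched X pA pB := fun b a hab => funext fun f => f.2 b a hab
  have hcard : ∀ a b, pA a = pB b → ∀ c,
      (Finset.univ.filter fun x => FirstOrder.Language.Structure.RelMap E ![a, x] ∧
        pA x = c).card =
      (Finset.univ.filter fun x => FirstOrder.Language.Structure.RelMap E ![b, x] ∧
        pB x = c).card := by
    intro a b hab c
    have hg := (hm.indicator c).mulVec hX hX hN hN'
    -- The number of neighbours of colour `c` is a matched function, hence one of the coordinates of
    -- the colour.
    have := congrFun hab ⟨Sum.elim _ _, hg⟩
    simp only [pA, pB, Sum.elim_inl, Sum.elim_inr] at this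
    have h2 := (adjMatrix_mulVec_indicator E pA c a).symm.trans
      (this.trans (adjMatrix_mulVec_indicator E pB c b))
    exact Nat.cast_injective h2
  refine haveCommonEquitablePartition_of_patternCount pA pB
    (hX.card_fibre_eq_of_matched hm) ?_
  intro a b hab R i π v
  obtain rfl := hA.only_symbol R
  rw [hA.patternCount_eq pA i π v a, hB.patternCount_eq pB i π v b, hab, hcard a b hab]

end Graphs

/-! ### Constrained sums over trees by leaf elimination. -/

section TreeSums

theorem sum_univ_congr_of_fintype {α M : Type*} [AddCommMonoid M] {i₁ i₂ : Fintype α}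
    {f g : α → M} (h : ∀ x, f x = g x) :
    ∑ x ∈ @Finset.univ α i₁, f x = ∑ x ∈ @Finset.univ α i₂, g x := by
  obtain rfl := Subsingleton.elim i₁ i₂
  exact Finset.sum_congr rfl fun x _ => h x

open scoped Classical in
/-- The weighted number of assignments of values to the vertices of a graph that satisfy a
constraint along each edge. -/
noncomputable def edgeConstrainedSum {V X I : Type*} [Fintype V] [Fintype X] (G : SimpleGraph V)
    (R : V → V → X → X → Prop) (p : X → I) (w : V → I → ℕ) : ℕ :=
  ∑ h : V → X, if ∀ a b, G.Adj a b → R a b (h a) (h b) then ∏ a, w a (p (h a)) else 0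

open scoped Classical in
/-- Summing over the value at a leaf changes the weight of its neighbour. -/
theorem edgeConstrainedSum_leaf {V X I : Type*} [Fintype V] [Fintype X] {G : SimpleGraph V}
    {R : V → V → X → X → Prop} {p : X → I} {w : V → I → ℕ} {v u : V} (huv : G.Adj v u)
    (hu : ∀ a, G.Adj v a → a = u) (hR : ∀ a b x y, R a b x y ↔ R b a y x) {N : I → ℕ}
    (hN : ∀ x, (∑ y, if R u v x y then w v (p y) else 0) = N (p x)) :
    edgeConstrainedSum G R p w = edgeConstrainedSum (G.induce {a | a ≠ v})
      (fun a b => R a b) p (fun a i => w a i * if a.1 = u then N i else 1) := by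
  unfold edgeConstrainedSum
  rw [← (Equiv.funSplitAt v X).symm.sum_comp, Fintype.sum_prod_type, Finset.sum_comm]
  refine sum_univ_congr_of_fintype fun h => ?_
  have hval : ∀ x, ∀ a : {a // a ≠ v}, (Equiv.funSplitAt v X).symm (x, h) a.1 = h a := by
    intro x a
    simp [Equiv.funSplitAt, Equiv.piSplitAt, a.2]
  have hv : ∀ x, (Equiv.funSplitAt v X).symm (x, h) v = x := by
    intro x
    simp [Equiv.funSplitAt, Equiv.piSplitAt]
  -- Since `u` is the only neighbour of `v`, the value at `v` enters a single edge condition.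
  have hcond : ∀ x, (∀ a b, G.Adj a b → R a b ((Equiv.funSplitAt v X).symm (x, h) a)
      ((Equiv.funSplitAt v X).symm (x, h) b)) ↔
      ((∀ a b : {a | a ≠ v}, (G.induce {a | a ≠ v}).Adj a b → R a b (h a) (h b)) ∧
        R u v (h ⟨u, huv.ne'⟩) x) := by
    intro x
    constructor
    · intro H
      refine ⟨fun a b hab => ?_, ?_⟩
      · have := H a.1 b.1 hab
        rwa [hval x a, hval x b] at this
      · have := H u v huv.symm
        rwa [hv, hval x ⟨u, huv.ne'⟩] at this
    · rintro ⟨H1, H2⟩ a b hab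
      by_cases ha : a = v
      · subst ha
        obtain rfl := hu b hab
        rw [hR, hv, hval x ⟨b, huv.ne'⟩]
        exact H2
      · by_cases hb : b = v
        · subst hb
          obtain rfl := hu a hab.symm
          rw [hv, hval x ⟨a, huv.ne'⟩]
          exact H2
        · rw [hval x ⟨a, ha⟩, hval x ⟨b, hb⟩]
          exact H1 ⟨a, ha⟩ ⟨b, hb⟩ hab
  have hprod : ∀ x, ∏ a, w a (p ((Equiv.funSplitAt v X).symm (x, h) a)) =
      w v (p x) * ∏ a : {a // a ≠ v}, w a (p (h a)) := by
    intro x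
    rw [Fintype.prod_eq_mul_prod_subtype_ne _ v, hv]
    congr 1
    exact Finset.prod_congr rfl fun a _ => by rw [hval]
  have hu' : ∏ a : {a // a ≠ v}, (if a.1 = u then N (p (h a)) else 1) = N (p (h ⟨u, huv.ne'⟩)) := by
    rw [Finset.prod_eq_single (⟨u, huv.ne'⟩ : {a // a ≠ v})]
    · simp
    · intro b _ hb
      rw [if_neg]
      exact fun h' => hb (Subtype.ext h')
    · simp
  simp only [hcond, hprod]
  by_cases hc : ∀ a b : {a | a ≠ v}, (G.induce {a | a ≠ v}).Adj a b → R a b (h a) (h b)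
  · rw [if_pos hc]
    refine Eq.trans ?_ (Finset.prod_mul_distrib.trans (congrArg _ hu')).symm
    rw [← hN, Finset.mul_sum]
    refine Finset.sum_congr rfl fun x _ => ?_
    by_cases hx : R u v (h ⟨u, huv.ne'⟩) x
    · rw [if_pos ⟨hc, hx⟩, if_pos hx]
      exact mul_comm _ _
    · rw [if_neg fun h' => hx h'.2, if_neg hx, mul_zero]
  · rw [if_neg hc]
    exact Finset.sum_eq_zero fun x _ => if_neg fun h' => hc h'.1

/-- The last hypothesis is equitability: a weighted sum over the values at a neighbour depends only
on the colour, through the same `N` on both sides. Removing a leaf multiplies the weight of its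
neighbour by `N`, so the weights still agree; this is why the induction is over all weights. At a
single vertex `hpq` concludes. -/
theorem edgeConstrainedSum_eq_of_isTree {X Y I : Type*} [Fintype X] [Fintype Y] {p : X → I}
    {q : Y → I} (hpq : ∀ w : I → ℕ, ∑ x, w (p x) = ∑ y, w (q y)) (n : ℕ) :
    ∀ {V : Type w} [Fintype V] (G : SimpleGraph V) (R : V → V → X → X → Prop)
      (R' : V → V → Y → Y → Prop) (w : V → I → ℕ), Fintype.card V = n → G.IsTree →
      (∀ a b x y, R a b x y ↔ R b a y x) → (∀ a b x y, R' a b x y ↔ R' b a y x) →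
      (∀ (a b : V) (w : I → ℕ), ∃ N : I → ℕ, by classical exact
        (∀ x, (∑ y, if R a b x y then w (p y) else 0) = N (p x)) ∧
        (∀ x, (∑ y, if R' a b x y then w (q y) else 0) = N (q x))) →
      edgeConstrainedSum G R p w = edgeConstrainedSum G R' q w := by
  classical
  induction n with
  | zero =>
    intro V _ G R R' w hV hG
    have := hG.connected.nonempty
    exact (Fintype.card_ne_zero hV).elim
  | succ n ih =>
    intro V _ G R R' w hV hG hR hR' hN
    rcases subsingleton_or_nontrivial V with hs | hnt
    · obtain ⟨v⟩ := hG.connected.nonempty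
      have : Unique V := ⟨⟨v⟩, fun _ => Subsingleton.elim _ _⟩
      have hadj : ∀ a b, ¬ G.Adj a b := fun a b hab => hab.ne (Subsingleton.elim _ _)
      unfold edgeConstrainedSum
      simp only [hadj, false_implies, implies_true, if_true, Fintype.prod_unique]
      refine (sum_univ_congr_of_fintype fun _ => rfl).trans
        (((Fintype.sum_equiv (Equiv.funUnique V X) _ _ fun _ => rfl).trans
        ((hpq (w default)).trans
          (Fintype.sum_equiv (Equiv.funUnique V Y) _ _ fun _ => rfl).symm)).trans
        (sum_univ_congr_of_fintype fun _ => rfl))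
    · obtain ⟨v, hv⟩ := hG.exists_vert_degree_one_of_nontrivial
      obtain ⟨u, huv, hu⟩ := SimpleGraph.degree_eq_one_iff_existsUnique_adj.1 hv
      obtain ⟨N, h1, h2⟩ := hN u v (w v)
      rw [edgeConstrainedSum_leaf huv hu hR (N := N) (by convert h1),
        edgeConstrainedSum_leaf huv hu hR' (N := N) (by convert h2)]
      refine ih _ _ _ _ ?_ ⟨?_, hG.isAcyclic.induce _⟩ (fun _ _ _ _ => hR _ _ _ _)
        (fun _ _ _ _ => hR' _ _ _ _) (fun a b => hN a b)
      · have : Fintype.card {a // a ≠ v} = Fintype.card V - 1 := by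
          rw [Fintype.card_subtype_compl]; simp
        rw [hV, Nat.add_sub_cancel] at this
        convert this
      · exact hG.connected.induce_compl_singleton_of_degree_eq_one hv

end TreeSums

/-! ### Homomorphisms as assignments on the factor graph: 3 → 4. -/

section Homs

variable {σ : FirstOrder.Language.{u, v}}

/-- The constraint on the images of an element and of a constraint of `T` that says that the
former occurs in the latter where it has to. -/
def incidenceRel {T A : Type*} [σ.Structure T] [σ.Structure A] :
    T ⊕ Constraint σ T → T ⊕ Constraint σ T → A ⊕ Constraint σ A → A ⊕ Constraint σ A → Prop
  -- `S` may exceed the set of positions of `t` in `C`, because a homomorphism may identify entries.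
  | .inl t, .inr C, .inl a, .inr D =>
      ∃ S : Finset (Fin C.sym.1), (∀ i, C.tuple i = t → i ∈ S) ∧ labelMatrix σ A a D = ⟨C.sym, S⟩
  | .inr C, .inl t, .inr D, .inl a =>
      ∃ S : Finset (Fin C.sym.1), (∀ i, C.tuple i = t → i ∈ S) ∧ labelMatrix σ A a D = ⟨C.sym, S⟩
  | _, _, _, _ => False

theorem incidenceRel_symm {T A : Type*} [σ.Structure T] [σ.Structure A]
    (u v : T ⊕ Constraint σ T) (x y : A ⊕ Constraint σ A) :
    incidenceRel u v x y ↔ incidenceRel v u y x := by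
  rcases u with t | C <;> rcases v with s | D <;> rcases x with a | E <;> rcases y with b | F <;>
    exact Iff.rfl

/-- The assignment of elements and constraints of `A` induced by a homomorphism `T → A`. -/
def homAssignment {T A : Type*} [σ.Structure T] [σ.Structure A] (f : T →[σ] A) :
    T ⊕ Constraint σ T → A ⊕ Constraint σ A
  | .inl t => .inl (f t)
  | .inr C => .inr ⟨C.sym, f ∘ C.tuple, f.map_rel C.sym.2 C.tuple C.holds⟩

/-- The edges at a constraint prescribe each entry of its image; positive arity supplies at least
one edge, which fixes the relation symbol. -/
theorem range_homAssignment [σ.IsRelational] [IsEmpty (σ.Relations 0)] {T A : Type*}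
    [σ.Structure T] [σ.Structure A] (h : T ⊕ Constraint σ T → A ⊕ Constraint σ A) :
    (∃ f : T →[σ] A, homAssignment f = h) ↔ (∀ x, (h x).isLeft = x.isLeft) ∧
      ∀ x y, (factorGraph σ T).Adj x y → incidenceRel x y (h x) (h y) := by
  classical
  constructor
  · rintro ⟨f, rfl⟩
    refine ⟨by rintro (t | C) <;> rfl, ?_⟩
    have key : ∀ (t : T) (C : Constraint σ T),
        incidenceRel (.inl t) (.inr C) (homAssignment f (.inl t)) (homAssignment f (.inr C)) := by
      intro t C
      refine ⟨Finset.univ.filter fun i => f t = f (C.tuple i), fun i hi => by simp [hi], ?_⟩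
      rw [labelMatrix_mk_eq_iff]
      rfl
    rintro (t | C) (s | D) hadj
    · exact hadj.elim
    · exact key t D
    · exact (incidenceRel_symm _ _ _ _).1 (key s C)
    · exact hadj.elim
  · rintro ⟨hs, hr⟩
    have h1 : ∀ t, ∃ a, h (.inl t) = .inl a := fun t => Sum.isLeft_iff.1 (hs (.inl t))
    choose f hf using h1
    have h2 : ∀ C : Constraint σ T, ∃ ht : FirstOrder.Language.Structure.RelMap C.sym.2
        (f ∘ C.tuple), h (.inr C) = .inr ⟨C.sym, f ∘ C.tuple, ht⟩ := by
      intro C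
      obtain ⟨D, hD⟩ : ∃ D, h (.inr C) = .inr D := by
        rw [← Sum.isRight_iff, ← Sum.not_isLeft, hs]
        simp
      have h3 : ∀ i, ∃ S : Finset (Fin C.sym.1), (∀ j, C.tuple j = C.tuple i → j ∈ S) ∧
          labelMatrix σ A (f (C.tuple i)) D = ⟨C.sym, S⟩ := by
        intro i
        have := hr (.inl (C.tuple i)) (.inr C) ⟨i, rfl⟩
        rw [hf, hD] at this
        exact this
      obtain ⟨R, s, hs⟩ := D
      have h0 := h3 ⟨0, C.arity_pos⟩
      obtain ⟨R', t, ht⟩ := C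
      obtain rfl : R = R' := by
        obtain ⟨S, -, hS⟩ := h0
        exact congrArg Sigma.fst hS
      have : s = f ∘ t := by
        funext i
        obtain ⟨S, hS, hS'⟩ := h3 i
        rw [labelMatrix_mk_eq_iff] at hS'
        have := hS i rfl
        rw [← hS'] at this
        simpa [eq_comm] using this
      subst this
      exact ⟨hs, hD⟩
    refine ⟨⟨f, fun {n} F => isEmptyElim F, fun {n} R t ht => (h2 ⟨⟨n, R⟩, t, ht⟩).1⟩, ?_⟩
    funext x
    rcases x with t | C
    · exact (hf t).symm
    · exact (h2 C).2.symm

theorem homAssignment_injective {T A : Type*} [σ.Structure T] [σ.Structure A] :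
    Function.Injective (homAssignment : (T →[σ] A) → _) := by
  intro f g hfg
  ext t
  exact Sum.inl_injective (congrFun hfg (.inl t))

variable [Finite (RelSymbol σ)]

/-- Homomorphisms from `T` to `A` counted as a sum over assignments on the factor graph of `T`. -/
theorem card_hom_eq_edgeConstrainedSum [σ.IsRelational] [IsEmpty (σ.Relations 0)] {T A I J : Type*}
    [σ.Structure T] [σ.Structure A] [Fintype T] [Fintype A] (p : A → I) (q : Constraint σ A → J) :
    Nat.card (T →[σ] A) = edgeConstrainedSum (factorGraph σ T) incidenceRel (Sum.map p q)
      (fun x i => if i.isLeft = x.isLeft then 1 else 0) := by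
  classical
  rw [← Nat.card_range_of_injective (homAssignment_injective (T := T) (A := A)),
    Nat.card_eq_fintype_card, Fintype.card_subtype]
  unfold edgeConstrainedSum
  rw [Finset.card_filter]
  refine sum_univ_congr_of_fintype fun h => ?_
  -- The product of the weights tests that elements go to elements and constraints to constraints.
  simp only [Set.mem_range, range_homAssignment, Finset.prod_ite_zero, Finset.prod_const_one,
    Finset.mem_univ, true_implies, Sum.isLeft_map]
  split_ifs <;> tauto

variable {A B : Type*} [σ.Structure A] [σ.Structure B] [Fintype A] [Fintype B]

theorem HaveCommonEquitablePartition.sameFTreeHoms [σ.IsRelational] [IsEmpty (σ.Relations 0)]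
    (h : HaveCommonEquitablePartition σ A B) : SameFTreeHoms σ A B := by
  classical
  obtain ⟨I, J, pA, qA, pB, qB, c, d, hA, hB, hp, hq⟩ := h
  intro T _ _ hT
  have := Fintype.ofFinite T
  obtain ⟨e, he⟩ := exists_equiv_of_card_fibres (f := pA) (g := pB) (by convert hp)
  obtain ⟨e', he'⟩ := exists_equiv_of_card_fibres (f := qA) (g := qB) (by convert hq)
  have hglob : ∀ x, Sum.map pB qB (Equiv.sumCongr e e' x) = Sum.map pA qA x := by
    rintro (a | C)
    · exact congrArg Sum.inl (he a)
    · exact congrArg Sum.inr (he' C)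
  -- The equitable parameters give the bijection on the sort opposite to `x`; on the sort of `x`
  -- nothing is incident and the global bijection serves.
  have hloc : ∀ x y, Sum.map pA qA x = Sum.map pB qB y →
      ∃ ε : A ⊕ Constraint σ A ≃ B ⊕ Constraint σ B, ∀ z, Sum.map pB qB (ε z) = Sum.map pA qA z ∧
        ∀ u v : T ⊕ Constraint σ T, incidenceRel u v x z ↔ incidenceRel u v y (ε z) := by
    rintro (a | C) (b | D) hxy
    · obtain ⟨φ, hφ⟩ := exists_equiv_of_card_fibres
        (f := fun C => (qA C, labelMatrix σ A a C)) (g := fun D => (qB D, labelMatrix σ B b D)) (by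
          rintro ⟨j, ℓ⟩
          have h1 := hA.card_constraints a j ℓ
          have h2 := hB.card_constraints b j ℓ
          rw [← Sum.inl_injective hxy, ← h1] at h2
          simp only [Prod.mk.injEq]
          convert h2.symm)
      simp only [Prod.mk.injEq] at hφ
      refine ⟨Equiv.sumCongr e φ, ?_⟩
      rintro (a' | C)
      · refine ⟨congrArg Sum.inl (he a'), ?_⟩
        rintro (t | E) (s | F) <;> exact Iff.rfl
      · refine ⟨congrArg Sum.inr (hφ C).1, ?_⟩
        rintro (t | E) (s | F) <;> try exact Iff.rfl
        simp only [Equiv.sumCongr_apply, Sum.map_inr, incidenceRel, (hφ C).2]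
    · simp at hxy
    · simp at hxy
    · obtain ⟨φ, hφ⟩ := exists_equiv_of_card_fibres
        (f := fun a => (pA a, labelMatrix σ A a C)) (g := fun b => (pB b, labelMatrix σ B b D)) (by
          rintro ⟨j, ℓ⟩
          have h1 := hA.card_elements C j ℓ
          have h2 := hB.card_elements D j ℓ
          rw [← Sum.inr_injective hxy, ← h1] at h2
          simp only [Prod.mk.injEq]
          convert h2.symm)
      simp only [Prod.mk.injEq] at hφ
      refine ⟨Equiv.sumCongr φ e', ?_⟩
      rintro (a' | C')
      · refine ⟨congrArg Sum.inl (hφ a').1, ?_⟩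
        rintro (t | E) (s | F) <;> try exact Iff.rfl
        simp only [Equiv.sumCongr_apply, Sum.map_inl, incidenceRel, (hφ a').2]
      · refine ⟨congrArg Sum.inr (he' C'), ?_⟩
        rintro (t | E) (s | F) <;> exact Iff.rfl
  rw [card_hom_eq_edgeConstrainedSum pA qA, card_hom_eq_edgeConstrainedSum pB qB]
  refine edgeConstrainedSum_eq_of_isTree ?_ _ _ _ _ _ rfl hT incidenceRel_symm incidenceRel_symm ?_
  · intro w
    exact Fintype.sum_equiv (Equiv.sumCongr e e') _ _ fun x => by rw [hglob]
  · intro u v w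
    have hsum : ∀ x y, Sum.map pA qA x = Sum.map pB qB y →
        (∑ z, if incidenceRel u v x z then w (Sum.map pA qA z) else 0) =
          ∑ z, if incidenceRel u v y z then w (Sum.map pB qB z) else 0 := by
      intro x y hxy
      obtain ⟨ε, hε⟩ := hloc x y hxy
      exact Fintype.sum_equiv ε _ _ fun z => by simp only [(hε z).1, (hε z).2 u v]
    -- `N` is evaluated at a representative in `B`; the default `0` is never used.
    refine ⟨fun i => if h : ∃ y, Sum.map pB qB y = i then
      ∑ z, if incidenceRel u v h.choose z then w (Sum.map pB qB z) else 0 else 0, ?_, ?_⟩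
    · intro x
      have h : ∃ y, Sum.map pB qB y = Sum.map pA qA x := ⟨_, hglob x⟩
      simp only [dif_pos h]
      convert hsum x _ h.choose_spec.symm
    · intro y
      have h : ∃ y', Sum.map pB qB y' = Sum.map pB qB y := ⟨y, rfl⟩
      simp only [dif_pos h]
      have hx := hglob ((Equiv.sumCongr e e').symm y)
      rw [Equiv.apply_symm_apply] at hx
      convert (hsum _ y hx.symm).symm.trans (hsum _ _ (hx.symm.trans h.choose_spec.symm))

end Homs

/-! ### A numerical criterion for factor-trees. -/

section TreeCriterion

variable {σ : FirstOrder.Language.{u, v}}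

/-- The incidences of elements and constraints are the edges of the factor graph. -/
noncomputable def incidenceEquivEdgeSet (T : Type w) [σ.Structure T] :
    (Σ C : Constraint σ T, Set.range C.tuple) ≃ (factorGraph σ T).edgeSet := by
  refine Equiv.ofBijective (fun z => ⟨s(.inl z.2.1, .inr z.1), z.2.2⟩) ⟨?_, ?_⟩
  · rintro ⟨C, t, ht⟩ ⟨D, s, hs⟩ h
    rcases Sym2.eq_iff.1 (congrArg Subtype.val h) with ⟨h₁, h₂⟩ | ⟨h₁, h₂⟩
    · obtain rfl : t = s := Sum.inl_injective h₁
      obtain rfl : C = D := Sum.inr_injective h₂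
      rfl
    · exact (Sum.inl_ne_inr h₁).elim
  · rintro ⟨e, he⟩
    induction e using Sym2.ind with
    | _ x y =>
      rcases x with t | C <;> rcases y with s | D
      · exact he.elim
      · exact ⟨⟨D, t, he⟩, rfl⟩
      · exact ⟨⟨C, s, he⟩, Subtype.ext Sym2.eq_swap⟩
      · exact he.elim

/-- A tree is a connected graph with `|V| = |E| + 1`; here `|V|` is `|T|` plus the number of
constraints and `|E|` sums the range sizes. Connectedness already gives `|V| ≤ |E| + 1`, so one
inequality suffices. Positive arity makes the truncated subtraction exact. -/
theorem isFTree_iff_connected_and_sum [Finite (RelSymbol σ)] [IsEmpty (σ.Relations 0)]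
    (T : Type w) [σ.Structure T] [Finite T] :
    IsFTree σ T ↔ (factorGraph σ T).Connected ∧
      ∑ C : Constraint σ T, ((Set.range C.tuple).ncard - 1) + 1 ≤ Nat.card T := by
  have hE : Nat.card (factorGraph σ T).edgeSet =
      ∑ C : Constraint σ T, (Set.range C.tuple).ncard := by
    rw [← Nat.card_congr (incidenceEquivEdgeSet T), Nat.card_sigma]
    rfl
  have hpos : ∀ C : Constraint σ T, 1 ≤ (Set.range C.tuple).ncard := fun C =>
    (Set.ncard_pos (Set.toFinite _)).2 ⟨_, ⟨0, C.arity_pos⟩, rfl⟩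
  have hS : ∑ C : Constraint σ T, (Set.range C.tuple).ncard =
      ∑ C : Constraint σ T, ((Set.range C.tuple).ncard - 1) + Nat.card (Constraint σ T) := by
    rw [Nat.card_eq_fintype_card, ← Finset.card_univ, Finset.card_eq_sum_ones,
      ← Finset.sum_add_distrib]
    exact Finset.sum_congr rfl fun C _ => (Nat.sub_add_cancel (hpos C)).symm
  unfold IsFTree
  rw [SimpleGraph.isTree_iff_connected_and_card, hE, hS, Nat.card_sum]
  refine and_congr_right fun hc => ⟨fun h => by omega, fun h => ?_⟩
  have := hc.card_vert_le_card_edgeSet_add_one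
  rw [hE, hS, Nat.card_sum] at this
  omega

/-- The image of a constraint under a homomorphism. -/
def Constraint.map {T T' : Type*} [σ.Structure T] [σ.Structure T'] (f : T →[σ] T')
    (C : Constraint σ T) : Constraint σ T' :=
  ⟨C.sym, f ∘ C.tuple, f.map_rel C.sym.2 C.tuple C.holds⟩

/-- The map of factor graphs induced by a homomorphism. -/
def factorGraphHom {T T' : Type*} [σ.Structure T] [σ.Structure T'] (f : T →[σ] T') :
    factorGraph σ T →g factorGraph σ T' where
  toFun := Sum.map f (Constraint.map f)
  map_rel' := by
    rintro (t | C) (s | D) h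
    · exact h.elim
    · obtain ⟨i, rfl⟩ := h
      exact ⟨i, rfl⟩
    · obtain ⟨i, rfl⟩ := h
      exact ⟨i, rfl⟩
    · exact h.elim

end TreeCriterion

/-! ### Gluing two structures at a point. -/

section Wedge

variable {σ : FirstOrder.Language.{u, v}}

/-- The structure obtained from `T₁` and `T₂` by identifying `x : T₁` with `r : T₂`. -/
def Wedge {T₁ T₂ : Type w} (_ : T₁) (r : T₂) : Type w := T₁ ⊕ {y : T₂ // y ≠ r}

variable {T₁ T₂ : Type w} {x : T₁} {r : T₂}

instance [Finite T₁] [Finite T₂] : Finite (Wedge x r) :=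
  inferInstanceAs (Finite (T₁ ⊕ {y : T₂ // y ≠ r}))

/-- The inclusion of the first part into a wedge. -/
def Wedge.inl (x : T₁) (r : T₂) (t : T₁) : Wedge x r := Sum.inl t

open scoped Classical in
/-- The inclusion of the second part into a wedge. -/
noncomputable def Wedge.inr (x : T₁) (r : T₂) (t : T₂) : Wedge x r :=
  if h : t = r then Sum.inl x else Sum.inr ⟨t, h⟩

theorem Wedge.inl_eq_inr : Wedge.inl x r x = Wedge.inr x r r :=
  (show Wedge.inr x r r = Wedge.inl x r x from dif_pos rfl).symm

theorem Wedge.inr_of_ne {t : T₂} (h : t ≠ r) : Wedge.inr x r t = Sum.inr ⟨t, h⟩ := dif_neg h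

theorem Wedge.exists_rep (z : Wedge x r) :
    (∃ t, z = Wedge.inl x r t) ∨ ∃ t, z = Wedge.inr x r t := by
  rcases z with t | ⟨t, ht⟩
  · exact Or.inl ⟨t, rfl⟩
  · exact Or.inr ⟨t, (Wedge.inr_of_ne ht).symm⟩

theorem Wedge.card_add_one [Finite T₁] [Finite T₂] :
    Nat.card (Wedge x r) + 1 = Nat.card T₁ + Nat.card T₂ := by
  have := Fintype.ofFinite T₁
  have := Fintype.ofFinite T₂
  classical
  have h1 : Nat.card (Wedge x r) = Nat.card (T₁ ⊕ {y : T₂ // y ≠ r}) := rfl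
  have h2 : 0 < Fintype.card T₂ := Fintype.card_pos_iff.2 ⟨r⟩
  rw [h1, Nat.card_sum, Nat.card_eq_fintype_card (α := {y : T₂ // y ≠ r}),
    Fintype.card_subtype_compl, Nat.card_eq_fintype_card (α := T₂)]
  simp only [Fintype.card_unique]
  omega

variable [σ.IsRelational] [σ.Structure T₁] [σ.Structure T₂]

instance : σ.Structure (Wedge x r) where
  funMap F := isEmptyElim F
  RelMap R t := (∃ s, FirstOrder.Language.Structure.RelMap R s ∧ Wedge.inl x r ∘ s = t) ∨
    ∃ s, FirstOrder.Language.Structure.RelMap R s ∧ Wedge.inr x r ∘ s = t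

/-- A map that preserves relations, as a homomorphism of relational structures. -/
def relHom {T A : Type*} [σ.Structure T] [σ.Structure A] (f : T → A)
    (h : ∀ {n} (R : σ.Relations n) (t : Fin n → T), FirstOrder.Language.Structure.RelMap R t →
      FirstOrder.Language.Structure.RelMap R (f ∘ t)) : T →[σ] A :=
  ⟨f, fun F => isEmptyElim F, h⟩

/-- The inclusion of the first part into a wedge, as a homomorphism. -/
def Wedge.inlHom (x : T₁) (r : T₂) : T₁ →[σ] Wedge x r :=
  relHom (Wedge.inl x r) fun _ t ht => Or.inl ⟨t, ht, rfl⟩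

/-- The inclusion of the second part into a wedge, as a homomorphism. -/
noncomputable def Wedge.inrHom (x : T₁) (r : T₂) : T₂ →[σ] Wedge x r :=
  relHom (Wedge.inr x r) fun _ t ht => Or.inr ⟨t, ht, rfl⟩

/-- The homomorphism from a wedge given by homomorphisms from its two parts. -/
def Wedge.desc {A : Type*} [σ.Structure A] (f : T₁ →[σ] A) (g : T₂ →[σ] A)
    (h : f x = g r) : Wedge x r →[σ] A :=
  relHom (Sum.elim f fun y => g y.1) (by
    have hg : ∀ t, (Sum.elim f fun y : {y : T₂ // y ≠ r} => g y.1) (Wedge.inr x r t) = g t := by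
      intro t
      by_cases ht : t = r
      · rw [ht, ← Wedge.inl_eq_inr]; exact h
      · rw [Wedge.inr_of_ne ht]; rfl
    rintro n R t (⟨s, hs, rfl⟩ | ⟨s, hs, rfl⟩)
    · exact f.map_rel R s hs
    · have := g.map_rel R s hs
      convert this using 1
      funext i
      exact hg (s i))

theorem Wedge.desc_inr {A : Type*} [σ.Structure A] (f : T₁ →[σ] A) (g : T₂ →[σ] A)
    (h : f x = g r) (t : T₂) : Wedge.desc f g h (Wedge.inr x r t) = g t := by
  by_cases ht : t = r
  · rw [ht, ← Wedge.inl_eq_inr]; exact h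
  · rw [Wedge.inr_of_ne ht]; rfl

/-- Homomorphisms from a wedge are compatible pairs of homomorphisms from its parts. -/
noncomputable def Wedge.homEquiv (σ : FirstOrder.Language.{u, v}) [σ.IsRelational]
    [σ.Structure T₁] [σ.Structure T₂] (x : T₁) (r : T₂) (A : Type*) [σ.Structure A] :
    (Wedge x r →[σ] A) ≃ {z : (T₁ →[σ] A) × (T₂ →[σ] A) // z.1 x = z.2 r} where
  toFun f := ⟨(f.comp (Wedge.inlHom x r), f.comp (Wedge.inrHom x r)),
    congrArg f Wedge.inl_eq_inr⟩
  invFun z := Wedge.desc z.1.1 z.1.2 z.2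
  left_inv f := by
    ext z
    rcases Wedge.exists_rep z with ⟨t, rfl⟩ | ⟨t, rfl⟩
    · rfl
    · exact Wedge.desc_inr _ _ _ t
  right_inv z := by
    refine Subtype.ext (Prod.ext ?_ ?_)
    · ext t
      rfl
    · ext t
      exact Wedge.desc_inr _ _ z.2 t

theorem sum_le_sum_of_surjective {α β : Type*} [Fintype α] [Fintype β] {φ : α → β}
    (hφ : Function.Surjective φ) (g : β → ℕ) : ∑ b, g b ≤ ∑ a, g (φ a) := by
  classical
  obtain ⟨s, hs⟩ := hφ.hasRightInverse
  calc ∑ b, g b = ∑ b, g (φ (s b)) := by simp only [hs _]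
    _ = ∑ a ∈ Finset.univ.map ⟨s, hs.injective⟩, g (φ a) := by simp
    _ ≤ ∑ a, g (φ a) := Finset.sum_le_sum_of_subset (Finset.subset_univ _)

/-- Every constraint of the wedge comes from a part and ranges do not grow under maps. As the
criterion asks only for an upper bound, it need not be checked that constraints of the parts stay
distinct. -/
theorem Wedge.isFTree [Finite (RelSymbol σ)] [IsEmpty (σ.Relations 0)] [Finite T₁] [Finite T₂]
    (h₁ : IsFTree σ T₁) (h₂ : IsFTree σ T₂) : IsFTree σ (Wedge x r) := by
  classical
  rw [isFTree_iff_connected_and_sum] at *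
  have hrep : ∀ C : Constraint σ (Wedge x r), (∃ C₁, C = Constraint.map (Wedge.inlHom x r) C₁) ∨
      ∃ C₂, C = Constraint.map (Wedge.inrHom x r) C₂ := by
    rintro ⟨R, t, (⟨s, hs, rfl⟩ | ⟨s, hs, rfl⟩)⟩
    · exact Or.inl ⟨⟨R, s, hs⟩, rfl⟩
    · exact Or.inr ⟨⟨R, s, hs⟩, rfl⟩
  constructor
  · rw [SimpleGraph.connected_iff_exists_forall_reachable]
    refine ⟨.inl (Wedge.inl x r x), ?_⟩
    have e1 : ∀ y, (factorGraph σ (Wedge x r)).Reachable (.inl (Wedge.inl x r x))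
        (factorGraphHom (Wedge.inlHom x r) y) := fun y =>
      (h₁.1.preconnected (.inl x) y).map (factorGraphHom (Wedge.inlHom x r))
    have e2 : ∀ y, (factorGraph σ (Wedge x r)).Reachable (.inl (Wedge.inl x r x))
        (factorGraphHom (Wedge.inrHom x r) y) := fun y => by
      rw [Wedge.inl_eq_inr]
      exact (h₂.1.preconnected (.inl r) y).map (factorGraphHom (Wedge.inrHom x r))
    rintro (z | C)
    · rcases Wedge.exists_rep z with ⟨t, rfl⟩ | ⟨t, rfl⟩
      · exact e1 (.inl t)
      · exact e2 (.inl t)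
    · rcases hrep C with ⟨C, rfl⟩ | ⟨C, rfl⟩
      · exact e1 (.inr C)
      · exact e2 (.inr C)
  · have hsurj : Function.Surjective (Sum.elim (Constraint.map (σ := σ) (Wedge.inlHom x r))
        (Constraint.map (Wedge.inrHom x r))) := by
      intro C
      rcases hrep C with ⟨C, rfl⟩ | ⟨C, rfl⟩
      · exact ⟨.inl C, rfl⟩
      · exact ⟨.inr C, rfl⟩
    have hle : ∀ {T : Type w} [Finite T] [σ.Structure T] (f : T →[σ] Wedge x r)
        (C : Constraint σ T), (Set.range (C.map f).tuple).ncard - 1 ≤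
          (Set.range C.tuple).ncard - 1 := by
      intro T _ _ f C
      have : Set.range (C.map f).tuple = f '' Set.range C.tuple :=
        Set.range_comp f C.tuple
      rw [this]
      exact Nat.sub_le_sub_right (Set.ncard_image_le (Set.toFinite _)) 1
    have h3 := sum_le_sum_of_surjective hsurj fun C => (Set.range C.tuple).ncard - 1
    rw [Fintype.sum_sum_type] at h3
    have h4 := Finset.sum_le_sum fun (C : Constraint σ T₁) (_ : C ∈ Finset.univ) =>
      hle (Wedge.inlHom x r) C
    have h5 := Finset.sum_le_sum fun (C : Constraint σ T₂) (_ : C ∈ Finset.univ) =>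
      hle (Wedge.inrHom x r) C
    have h6 := Wedge.card_add_one (x := x) (r := r)
    simp only [Sum.elim_inl, Sum.elim_inr] at h3
    have h7 := h₁.2
    have h8 := h₂.2
    omega

end Wedge

/-! ### The point and the one-constraint star. -/

section BasicTrees

variable {σ : FirstOrder.Language.{u, v}} [σ.IsRelational]

/-- The structure with a single element and no constraints. -/
def PointTree (_ : FirstOrder.Language.{u, v}) : Type := Unit

instance : Unique (PointTree σ) := inferInstanceAs (Unique Unit)

instance : σ.Structure (PointTree σ) where
  funMap F := isEmptyElim F
  RelMap _ _ := False

instance : IsEmpty (Constraint σ (PointTree σ)) := ⟨fun C => C.holds⟩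

theorem PointTree.isFTree : IsFTree σ (PointTree σ) := by
  have : Unique (PointTree σ ⊕ Constraint σ (PointTree σ)) := (Equiv.sumEmpty _ _).unique
  exact SimpleGraph.IsTree.of_subsingleton

/-- Homomorphisms from a point are elements. -/
def PointTree.homEquiv (σ : FirstOrder.Language.{u, v}) [σ.IsRelational] (A : Type*)
    [σ.Structure A] : (PointTree σ →[σ] A) ≃ A where
  toFun f := f default
  invFun a := relHom (fun _ => a) fun _ _ h => h.elim
  left_inv f := by
    ext t
    rw [Subsingleton.elim t default]
    rfl
  right_inv _ := rfl

/-- The structure with a single constraint `R`, whose equality pattern is `π`. -/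
def StarTree {R : RelSymbol σ} (π : Setoid (Fin R.1)) : Type := Quotient π

variable {R : RelSymbol σ} {π : Setoid (Fin R.1)}

instance : Finite (StarTree π) := inferInstanceAs (Finite (Quotient π))

/-- The entries of the constraint of a star. -/
def StarTree.mk (π : Setoid (Fin R.1)) (i : Fin R.1) : StarTree π := Quotient.mk π i

instance : σ.Structure (StarTree π) where
  funMap F := isEmptyElim F
  RelMap {n} r t := (⟨⟨n, r⟩, t⟩ : Σ R : RelSymbol σ, Fin R.1 → StarTree π) =
    ⟨R, StarTree.mk π⟩

theorem StarTree.constraint_eq (C : Constraint σ (StarTree π)) :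
    C = ⟨R, StarTree.mk π, rfl⟩ := by
  obtain ⟨S, t, ht⟩ := C
  obtain rfl : S = R := congrArg Sigma.fst ht
  obtain rfl : t = StarTree.mk π := eq_of_heq (Sigma.mk.inj ht).2
  rfl

theorem StarTree.isFTree [Finite (RelSymbol σ)] [IsEmpty (σ.Relations 0)] :
    IsFTree σ (StarTree π) := by
  rw [isFTree_iff_connected_and_sum]
  let C₀ : Constraint σ (StarTree π) := ⟨R, StarTree.mk π, rfl⟩
  have hr : Set.range C₀.tuple = Set.univ := Set.range_eq_univ.2 Quotient.mk_surjective
  constructor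
  · rw [SimpleGraph.connected_iff_exists_forall_reachable]
    refine ⟨.inr C₀, ?_⟩
    rintro (t | C)
    · refine SimpleGraph.Adj.reachable ?_
      change t ∈ Set.range C₀.tuple
      rw [hr]
      trivial
    · rw [StarTree.constraint_eq C]
  · rw [Fintype.sum_eq_single C₀ fun C hC => (hC (StarTree.constraint_eq C)).elim, hr,
      Set.ncard_univ]
    have : 0 < Nat.card (StarTree π) :=
      Nat.card_pos_iff.2 ⟨⟨C₀.tuple ⟨0, C₀.arity_pos⟩⟩, inferInstance⟩
    omega

/-- Homomorphisms from a star are tuples of the relation that respect the pattern. -/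
def StarTree.homEquiv {R : RelSymbol σ} (ρ : Setoid (Fin R.1)) (A : Type*) [σ.Structure A] :
    (StarTree ρ →[σ] A) ≃
      {t : Fin R.1 → A // FirstOrder.Language.Structure.RelMap R.2 t ∧ ρ ≤ Setoid.ker t} where
  toFun f := ⟨f ∘ StarTree.mk ρ, f.map_rel R.2 (StarTree.mk ρ) rfl,
    fun _ _ h => congrArg f (Quotient.sound h)⟩
  invFun t := relHom (fun z => Quotient.lift t.1 (fun _ _ h => t.2.2 h) z) (by
    intro n r s hs
    obtain rfl : (⟨n, r⟩ : RelSymbol σ) = R := congrArg Sigma.fst hs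
    obtain rfl : s = StarTree.mk ρ := eq_of_heq (Sigma.mk.inj hs).2
    exact t.2.1)
  left_inv f := by
    ext z
    induction z using Quotient.ind
    rfl
  right_inv t := rfl

end BasicTrees

/-! ### Functions that count rooted trees, and their closure properties. -/

section Realizable

variable {σ : FirstOrder.Language.{u, v}}

/-- The number of homomorphisms from `T` to `A` that send the root `r` to `a`. -/
noncomputable def rootedHomCount (σ : FirstOrder.Language.{u, v}) {T A : Type*} [σ.Structure T]
    [σ.Structure A] (r : T) (a : A) : ℕ :=
  Nat.card {f : T →[σ] A // f r = a}

instance {T A : Type*} [σ.Structure T] [σ.Structure A] [Finite T] [Finite A] :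
    Finite (T →[σ] A) :=
  Finite.of_injective (fun f => (f : T → A)) DFunLike.coe_injective

variable {A B : Type*} [σ.Structure A] [σ.Structure B]

/-- The functions on the elements of `A` and `B` that count the homomorphisms from a rooted
tree. -/
def IsTreeCount (σ : FirstOrder.Language.{u, v}) {A B : Type*} [σ.Structure A] [σ.Structure B]
    (f : A ⊕ B → ℕ) : Prop :=
  ∃ (T : Type) (_ : Finite T) (_ : σ.Structure T) (r : T), IsFTree σ T ∧
    (∀ a, f (.inl a) = rootedHomCount σ r a) ∧ ∀ b, f (.inr b) = rootedHomCount σ r b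

/-- Summing over the image of the root counts all homomorphisms. -/
theorem IsTreeCount.sum_eq [Fintype A] [Fintype B] (h : SameFTreeHoms σ A B) {f : A ⊕ B → ℕ}
    (hf : IsTreeCount σ f) : ∑ a, f (.inl a) = ∑ b, f (.inr b) := by
  obtain ⟨T, _, _, r, hT, hA, hB⟩ := hf
  simp only [hA, hB, rootedHomCount]
  rw [← Nat.card_sigma, ← Nat.card_sigma,
    Nat.card_congr (Equiv.sigmaFiberEquiv fun f : T →[σ] A => f r),
    Nat.card_congr (Equiv.sigmaFiberEquiv fun f : T →[σ] B => f r)]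
  exact h T hT

/-- Sort the homomorphisms from `T` by their restriction along `e`. -/
theorem rootedHomCount_of_extension [Finite A] {T₀ T : Type*} [Finite T₀] [σ.Structure T₀]
    [Finite T] [σ.Structure T] (e : T₀ →[σ] T) (r : T₀) (c : (T₀ →[σ] A) → ℕ)
    (hc : ∀ f₀ : T₀ →[σ] A, Nat.card {f : T →[σ] A // f.comp e = f₀} = c f₀) (a : A) :
    rootedHomCount σ (e r) a = ∑ᶠ f₀ : {f₀ : T₀ →[σ] A // f₀ r = a}, c f₀ := by
  have := Fintype.ofFinite {f₀ : T₀ →[σ] A // f₀ r = a}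
  rw [finsum_eq_sum_of_fintype]
  simp only [← hc]
  rw [← Nat.card_sigma, rootedHomCount]
  refine Nat.card_congr
    { toFun := fun f => ⟨⟨f.1.comp e, f.2⟩, ⟨f.1, rfl⟩⟩
      invFun := fun z => ⟨z.2.1, (DFunLike.congr_fun z.2.2 r).trans z.1.2⟩
      left_inv := fun _ => rfl
      right_inv := ?_ }
  rintro ⟨⟨f₀, h₀⟩, ⟨f, hf⟩⟩
  change f.comp e = f₀ at hf
  subst hf
  rfl

variable [σ.IsRelational]

/-- Given `f₀`, the image of the gluing point is `f₀ x`, so the extensions to the two parts are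
chosen independently. -/
theorem Wedge.card_hom_over {T₀ T₁ T₂ : Type w} [σ.Structure T₀] [σ.Structure T₁]
    [σ.Structure T₂] (j : T₀ →[σ] T₁) (x : T₀) (r : T₂) (f₀ : T₀ →[σ] A) :
    Nat.card {f : Wedge (j x) r →[σ] A // f.comp ((Wedge.inlHom (j x) r).comp j) = f₀} =
      Nat.card {f : T₁ →[σ] A // f.comp j = f₀} * rootedHomCount σ r (f₀ x) := by
  rw [rootedHomCount, ← Nat.card_prod]
  let z : {z : {z : (T₁ →[σ] A) × (T₂ →[σ] A) // z.1 (j x) = z.2 r} // z.1.1.comp j = f₀} ≃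
      {f : T₁ →[σ] A // f.comp j = f₀} × {f : T₂ →[σ] A // f r = f₀ x} :=
    { toFun := fun z => (⟨z.1.1.1, z.2⟩, ⟨z.1.1.2, z.1.2.symm.trans (DFunLike.congr_fun z.2 x)⟩)
      invFun := fun z => ⟨⟨(z.1.1, z.2.1), (DFunLike.congr_fun z.1.2 x).trans z.2.2.symm⟩, z.1.2⟩
      left_inv := fun _ => rfl
      right_inv := fun _ => rfl }
  exact Nat.card_congr (((Wedge.homEquiv σ (j x) r A).subtypeEquiv
    (q := fun z => z.1.1.comp j = f₀) fun f => Iff.rfl).trans z)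

theorem IsTreeCount.one : IsTreeCount σ (1 : A ⊕ B → ℕ) := by
  refine ⟨PointTree σ, inferInstance, inferInstance, default, PointTree.isFTree, fun a => ?_,
    fun b => ?_⟩
  · rw [rootedHomCount, Nat.card_congr ((PointTree.homEquiv σ A).subtypeEquiv
      (p := fun f => f default = a) (q := fun x => x = a) fun _ => Iff.rfl)]
    simp
  · rw [rootedHomCount, Nat.card_congr ((PointTree.homEquiv σ B).subtypeEquiv
      (p := fun f => f default = b) (q := fun x => x = b) fun _ => Iff.rfl)]
    simp

open scoped Classical in
theorem finsum_starTree {A : Type*} [σ.Structure A] [Fintype A] {R : RelSymbol σ}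
    (π : Setoid (Fin R.1)) (i : Fin R.1) (a : A) (c : (Fin R.1 → A) → ℕ) :
    ∑ᶠ f₀ : {f₀ : StarTree π →[σ] A // f₀ (StarTree.mk π i) = a},
      c (f₀.1 ∘ StarTree.mk π) =
      ∑ t : Fin R.1 → A with FirstOrder.Language.Structure.RelMap R.2 t ∧ π ≤ Setoid.ker t ∧
        t i = a, c t := by
  have := Fintype.ofFinite {f₀ : StarTree π →[σ] A // f₀ (StarTree.mk π i) = a}
  rw [finsum_eq_sum_of_fintype]
  refine Finset.sum_bij (fun f₀ _ => f₀.1 ∘ StarTree.mk π) ?_ ?_ ?_ fun _ _ => rfl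
  · intro f₀ _
    simp only [Finset.mem_filter, Finset.mem_univ, true_and]
    exact ⟨f₀.1.map_rel R.2 (StarTree.mk π) rfl, fun _ _ h => congrArg f₀.1 (Quotient.sound h),
      f₀.2⟩
  · intro f₀ _ f₁ _ h
    exact Subtype.ext ((StarTree.homEquiv π A).injective (Subtype.ext h))
  · intro t ht
    simp only [Finset.mem_filter, Finset.mem_univ, true_and] at ht
    exact ⟨⟨(StarTree.homEquiv π A).symm ⟨t, ht.1, ht.2.1⟩, ht.2.2⟩, Finset.mem_univ _, rfl⟩

variable [Finite (RelSymbol σ)] [IsEmpty (σ.Relations 0)]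

/-- Gluing rooted trees to the elements `k j`, for `j` in `s`, of a tree. -/
theorem exists_tree_extension {T₀ : Type} [Finite T₀] [σ.Structure T₀] (hT₀ : IsFTree σ T₀)
    {ι : Type*} (k : ι → T₀) (g : ι → A ⊕ B → ℕ) (hg : ∀ j, IsTreeCount σ (g j)) (s : Finset ι) :
    ∃ (T : Type) (_ : Finite T) (_ : σ.Structure T) (e : T₀ →[σ] T), IsFTree σ T ∧
      (∀ f₀ : T₀ →[σ] A, Nat.card {f : T →[σ] A // f.comp e = f₀} =
        ∏ j ∈ s, g j (.inl (f₀ (k j)))) ∧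
      ∀ f₀ : T₀ →[σ] B, Nat.card {f : T →[σ] B // f.comp e = f₀} =
        ∏ j ∈ s, g j (.inr (f₀ (k j))) := by
  classical
  induction s using Finset.induction_on with
  | empty =>
    refine ⟨T₀, inferInstance, inferInstance, FirstOrder.Language.Hom.id σ T₀, hT₀, ?_, ?_⟩
    · intro f₀
      simp
    · intro f₀
      simp
  | insert i s hi ih =>
    obtain ⟨T, _, _, e, hT, hA, hB⟩ := ih
    obtain ⟨T', _, _, r, hT', hA', hB'⟩ := hg i
    refine ⟨Wedge (e (k i)) r, inferInstance, inferInstance, (Wedge.inlHom (e (k i)) r).comp e,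
      Wedge.isFTree hT hT', fun f₀ => ?_, fun f₀ => ?_⟩
    · rw [Wedge.card_hom_over, hA, ← hA', Finset.prod_insert hi, mul_comm]
    · rw [Wedge.card_hom_over, hB, ← hB', Finset.prod_insert hi, mul_comm]

/-- Glue the two trees at their roots. -/
theorem IsTreeCount.mul [Finite A] [Finite B] {f g : A ⊕ B → ℕ} (hf : IsTreeCount σ f)
    (hg : IsTreeCount σ g) :
    IsTreeCount σ (f * g) := by
  obtain ⟨T₀, _, _, r, hT₀, hA₀, hB₀⟩ := hf
  obtain ⟨T, _, _, e, hT, hA, hB⟩ := exists_tree_extension hT₀ (fun _ : Unit => r) (fun _ => g)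
    (fun _ => hg) Finset.univ
  refine ⟨T, inferInstance, inferInstance, e r, hT, fun a => ?_, fun b => ?_⟩
  · rw [rootedHomCount_of_extension e r _ hA, Pi.mul_apply, hA₀, rootedHomCount]
    have := Fintype.ofFinite {f₀ : T₀ →[σ] A // f₀ r = a}
    have hc : ∀ f₀ : {f₀ : T₀ →[σ] A // f₀ r = a},
        (∏ _j : Unit, g (.inl (f₀.1 r))) = g (.inl a) := fun f₀ => by simp [f₀.2]
    rw [finsum_eq_sum_of_fintype, Nat.card_eq_fintype_card]
    simp only [hc, Finset.sum_const, Finset.card_univ, smul_eq_mul]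
  · rw [rootedHomCount_of_extension e r _ hB, Pi.mul_apply, hB₀, rootedHomCount]
    have := Fintype.ofFinite {f₀ : T₀ →[σ] B // f₀ r = b}
    have hc : ∀ f₀ : {f₀ : T₀ →[σ] B // f₀ r = b},
        (∏ _j : Unit, g (.inr (f₀.1 r))) = g (.inr b) := fun f₀ => by simp [f₀.2]
    rw [finsum_eq_sum_of_fintype, Nat.card_eq_fintype_card]
    simp only [hc, Finset.sum_const, Finset.card_univ, smul_eq_mul]

open scoped Classical in
/-- Weighted counts of the tuples of a relation that respect a pattern are tree counts. -/
theorem isTreeCount_star [Fintype A] [Fintype B] {R : RelSymbol σ} (π : Setoid (Fin R.1))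
    (i : Fin R.1) (g : Fin R.1 → A ⊕ B → ℕ) (hg : ∀ j, IsTreeCount σ (g j)) :
    IsTreeCount σ (Sum.elim
      (fun a => ∑ t : Fin R.1 → A with FirstOrder.Language.Structure.RelMap R.2 t ∧
        π ≤ Setoid.ker t ∧ t i = a, ∏ j, g j (.inl (t j)))
      (fun b => ∑ t : Fin R.1 → B with FirstOrder.Language.Structure.RelMap R.2 t ∧
        π ≤ Setoid.ker t ∧ t i = b, ∏ j, g j (.inr (t j)))) := by
  obtain ⟨T, _, _, e, hT, hA, hB⟩ := exists_tree_extension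
    (StarTree.isFTree (σ := σ) (π := π)) (StarTree.mk π) g hg Finset.univ
  refine ⟨T, inferInstance, inferInstance, e (StarTree.mk π i), hT, fun a => ?_, fun b => ?_⟩
  · rw [rootedHomCount_of_extension e _ _ hA]
    exact (finsum_starTree π i a fun t => ∏ j, g j (.inl (t j))).symm
  · rw [rootedHomCount_of_extension e _ _ hB]
    exact (finsum_starTree π i b fun t => ∏ j, g j (.inr (t j))).symm

end Realizable

/-! ### Linear algebra of spans of functions. -/

section SpanArguments

/-- A multilinear map that sends tuples of elements of `s` into a submodule sends tuples of
elements of the span of `s` into it. -/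
theorem multilinearMap_mem_of_mem_span {R ι E F : Type*} [CommRing R] [Finite ι]
    [AddCommGroup E] [Module R E] [AddCommGroup F] [Module R F]
    (Φ : MultilinearMap R (fun _ : ι => E) F) (s : Set E) (V : Submodule R F)
    (h : ∀ f : ι → E, (∀ j, f j ∈ s) → Φ f ∈ V) (f : ι → E)
    (hf : ∀ j, f j ∈ Submodule.span R s) : Φ f ∈ V := by
  classical
  have := Fintype.ofFinite ι
  -- Induction on the set `t` of coordinates allowed to leave `s` for its span.
  suffices H : ∀ (t : Finset ι) (f : ι → E), (∀ j, f j ∈ Submodule.span R s) →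
      (∀ j, j ∉ t → f j ∈ s) → Φ f ∈ V from
    H Finset.univ f hf fun j hj => (hj (Finset.mem_univ j)).elim
  intro t
  induction t using Finset.induction_on with
  | empty => exact fun f _ hf => h f fun j => hf j (Finset.notMem_empty j)
  | insert i t hi ih =>
    intro f hf hft
    have key : ∀ y ∈ Submodule.span R s, Φ (Function.update f i y) ∈ V := by
      intro y hy
      induction hy using Submodule.span_induction with
      | mem y hy =>
        refine ih _ (fun j => ?_) fun j hj => ?_
        · by_cases hij : j = i
          · subst hij
            rw [Function.update_self]
            exact Submodule.subset_span hy
          · rw [Function.update_of_ne hij]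
            exact hf j
        · by_cases hij : j = i
          · subst hij
            rw [Function.update_self]
            exact hy
          · rw [Function.update_of_ne hij]
            exact hft j fun h' => (Finset.mem_insert.1 h').elim hij hj
      | zero => rw [MultilinearMap.map_update_zero]; exact V.zero_mem
      | add y z _ _ hy hz => rw [MultilinearMap.map_update_add]; exact V.add_mem hy hz
      | smul c y _ hy => rw [MultilinearMap.map_update_smul]; exact V.smul_mem c hy
    have := key (f i) (hf i)
    rwa [Function.update_eq_self] at this

open scoped Classical in
/-- On a finite set, the span of a multiplicatively closed set of functions contains the
indicators of the sets of points that these functions do not separate. -/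
theorem indicator_mem_span {X K : Type*} [Finite X] [Field K] (M : Submonoid (X → K)) (x : X) :
    (fun y => if ∀ f ∈ M, f y = f x then (1 : K) else 0) ∈ Submodule.span K (M : Set (X → K)) := by
  have := Fintype.ofFinite X
  -- As `M` is a submonoid, its span is a subalgebra.
  have hspan : Subalgebra.toSubmodule (Algebra.adjoin K (M : Set (X → K))) =
      Submodule.span K (M : Set (X → K)) := by
    rw [Algebra.adjoin_eq_span, Submonoid.closure_eq]
  rw [← hspan, Subalgebra.mem_toSubmodule]
  have hsep : ∀ z : X, ¬ (∀ f ∈ M, f z = f x) → ∃ f ∈ M, f z ≠ f x := fun z hz => by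
    push Not at hz
    exact hz
  choose! f hfM hf using hsep
  -- Lagrange interpolation: each `z` separated from `x` contributes a factor that vanishes at `z`
  -- and equals `1` wherever no function of `M` separates from `x`.
  have key : (fun y => if ∀ f ∈ M, f y = f x then (1 : K) else 0) =
      ∏ z ∈ Finset.univ.filter (fun z => ¬ ∀ f ∈ M, f z = f x),
        (algebraMap K (X → K) (f z x - f z z)⁻¹ * (f z - algebraMap K (X → K) (f z z))) := by
    funext y
    simp only [Finset.prod_apply, Pi.mul_apply, Pi.sub_apply, Pi.algebraMap_apply,
      Algebra.algebraMap_self, RingHom.id_apply]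
    by_cases hy : ∀ f ∈ M, f y = f x
    · rw [if_pos hy, Finset.prod_eq_one]
      intro z hz
      have hz' := (Finset.mem_filter.1 hz).2
      rw [hy _ (hfM z hz'), inv_mul_cancel₀ (sub_ne_zero.2 (hf z hz').symm)]
    · rw [if_neg hy]
      refine (Finset.prod_eq_zero (i := y) (by simpa using hy) ?_).symm
      rw [sub_self, mul_zero]
  rw [key]
  refine Subalgebra.prod_mem _ fun z hz => Subalgebra.mul_mem _ (Subalgebra.algebraMap_mem _ _)
    (Subalgebra.sub_mem _ (Algebra.subset_adjoin (hfM z (Finset.mem_filter.1 hz).2))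
      (Subalgebra.algebraMap_mem _ _))

theorem eq_of_mem_span {X K : Type*} [Field K] {M : Set (X → K)} {x y : X}
    (h : ∀ f ∈ M, f x = f y) {f : X → K} (hf : f ∈ Submodule.span K M) : f x = f y := by
  induction hf using Submodule.span_induction with
  | mem f hf => exact h f hf
  | zero => rfl
  | add f g _ _ hf hg => rw [Pi.add_apply, Pi.add_apply, hf, hg]
  | smul c f _ hf => rw [Pi.smul_apply, Pi.smul_apply, hf]

end SpanArguments

/-! ### Sums over tuples that respect an equality pattern. -/

section StarSums

variable {σ : FirstOrder.Language.{u, v}}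

open scoped Classical in
-- Homomorphisms from a star see only `π ≤ ker t`; sort the tuples by their exact kernel `ρ`.
theorem sum_patternCount_Ici {A I : Type*} [σ.Structure A] [Fintype A] (p : A → I)
    (R : RelSymbol σ) (i : Fin R.1) (π : Setoid (Fin R.1)) [Fintype (Setoid (Fin R.1))]
    (v : Fin R.1 → I) (a : A) :
    ∑ t : Fin R.1 → A with FirstOrder.Language.Structure.RelMap R.2 t ∧ π ≤ Setoid.ker t ∧ t i = a,
      ∏ j, (if p (t j) = v j then (1 : ℚ) else 0) =
    ∑ ρ with π ≤ ρ, (patternCount p R i ρ v a : ℚ) := by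
  simp only [patternCount, Finset.card_filter, Finset.prod_ite_zero, Finset.prod_const_one]
  push_cast
  rw [Finset.sum_comm, Finset.sum_filter]
  refine Finset.sum_congr rfl fun t _ => ?_
  have hpt : p ∘ t = v ↔ ∀ j ∈ Finset.univ, p (t j) = v j := by
    simp [funext_iff]
  by_cases hπ : π ≤ Setoid.ker t
  · rw [Finset.sum_eq_single (Setoid.ker t)]
    · split_ifs <;> tauto
    · intro ρ _ hρ
      rw [if_neg]
      exact fun h => hρ h.2.1.1.symm
    · intro h
      simp [hπ] at h
  · rw [if_neg fun h => hπ h.2.1, Finset.sum_eq_zero]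
    intro ρ hρ
    rw [if_neg]
    rintro ⟨-, ⟨rfl, -⟩, -⟩
    exact hπ (Finset.mem_filter.1 hρ).2

open scoped Classical in
/-- Weighted sums over the tuples of a relation with a prescribed entry that respect a pattern,
as a multilinear function of the weights. -/
noncomputable def starMap (A B : Type*) [σ.Structure A] [σ.Structure B] [Fintype A] [Fintype B]
    (R : RelSymbol σ) (i : Fin R.1) (π : Setoid (Fin R.1)) :
    MultilinearMap ℚ (fun _ : Fin R.1 => A ⊕ B → ℚ) (A ⊕ B → ℚ) :=
  MultilinearMap.pi (Sum.rec
    (fun a => ∑ t : Fin R.1 → A with FirstOrder.Language.Structure.RelMap R.2 t ∧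
      π ≤ Setoid.ker t ∧ t i = a, (MultilinearMap.mkPiAlgebra ℚ (Fin R.1) ℚ).compLinearMap
        fun j => LinearMap.proj (.inl (t j)))
    (fun b => ∑ t : Fin R.1 → B with FirstOrder.Language.Structure.RelMap R.2 t ∧
      π ≤ Setoid.ker t ∧ t i = b, (MultilinearMap.mkPiAlgebra ℚ (Fin R.1) ℚ).compLinearMap
        fun j => LinearMap.proj (.inr (t j))))

variable {A B : Type*} [σ.Structure A] [σ.Structure B] [Fintype A] [Fintype B]

open scoped Classical in
theorem starMap_inl (R : RelSymbol σ) (i : Fin R.1) (π : Setoid (Fin R.1))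
    (f : Fin R.1 → A ⊕ B → ℚ) (a : A) :
    starMap A B R i π f (.inl a) = ∑ t : Fin R.1 → A with
      FirstOrder.Language.Structure.RelMap R.2 t ∧ π ≤ Setoid.ker t ∧ t i = a,
        ∏ j, f j (.inl (t j)) := by
  simp [starMap]

open scoped Classical in
theorem starMap_inr (R : RelSymbol σ) (i : Fin R.1) (π : Setoid (Fin R.1))
    (f : Fin R.1 → A ⊕ B → ℚ) (b : B) :
    starMap A B R i π f (.inr b) = ∑ t : Fin R.1 → B with
      FirstOrder.Language.Structure.RelMap R.2 t ∧ π ≤ Setoid.ker t ∧ t i = b,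
        ∏ j, f j (.inr (t j)) := by
  simp [starMap]

end StarSums

/-! ### From tree counts to an equitable partition: 4 → 3. -/

section Converse

variable {σ : FirstOrder.Language.{u, v}} [σ.IsRelational] [Finite (RelSymbol σ)]
  [IsEmpty (σ.Relations 0)] {A B : Type*} [σ.Structure A] [σ.Structure B]

/-- The tree counts, as rational functions on the elements of `A` and `B`. -/
def treeCounts (σ : FirstOrder.Language.{u, v}) [σ.IsRelational] [Finite (RelSymbol σ)]
    [IsEmpty (σ.Relations 0)] (A B : Type*) [σ.Structure A] [σ.Structure B] [Finite A] [Finite B] :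
    Submonoid (A ⊕ B → ℚ) where
  carrier := {f | ∃ g : A ⊕ B → ℕ, IsTreeCount σ g ∧ f = fun x => (g x : ℚ)}
  one_mem' := ⟨1, IsTreeCount.one, by funext x; simp⟩
  mul_mem' := by
    rintro _ _ ⟨f, hf, rfl⟩ ⟨g, hg, rfl⟩
    exact ⟨f * g, hf.mul hg, by funext x; simp⟩

variable [Fintype A] [Fintype B]

theorem sum_eq_of_mem_span_treeCounts (h : SameFTreeHoms σ A B) {f : A ⊕ B → ℚ}
    (hf : f ∈ Submodule.span ℚ (treeCounts σ A B : Set (A ⊕ B → ℚ))) :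
    ∑ a, f (.inl a) = ∑ b, f (.inr b) := by
  induction hf using Submodule.span_induction with
  | mem f hf =>
    obtain ⟨g, hg, rfl⟩ := hf
    simp only [← Nat.cast_sum, hg.sum_eq h]
  | zero => simp
  | add f g _ _ hf hg => simp only [Pi.add_apply, Finset.sum_add_distrib, hf, hg]
  | smul c f _ hf => simp only [Pi.smul_apply, ← Finset.smul_sum, hf]

/-- On tree counts `starMap` gives a tree count by `isTreeCount_star`; multilinearity extends this
to the span. -/
theorem starMap_mem_span (R : RelSymbol σ) (i : Fin R.1) (π : Setoid (Fin R.1))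
    (f : Fin R.1 → A ⊕ B → ℚ)
    (hf : ∀ j, f j ∈ Submodule.span ℚ (treeCounts σ A B : Set (A ⊕ B → ℚ))) :
    starMap A B R i π f ∈ Submodule.span ℚ (treeCounts σ A B : Set (A ⊕ B → ℚ)) := by
  refine multilinearMap_mem_of_mem_span _ _ _ (fun f hf => Submodule.subset_span ?_) f hf
  choose g hg hfg using hf
  refine ⟨_, isTreeCount_star π i g hg, ?_⟩
  funext x
  rcases x with a | b
  · rw [starMap_inl]
    simp only [hfg, Sum.elim_inl]
    push_cast
    rfl
  · rw [starMap_inr]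
    simp only [hfg, Sum.elim_inr]
    push_cast
    rfl

/-- The element colouring by the values of all tree counts. -/
def treeColour (σ : FirstOrder.Language.{u, v}) [σ.IsRelational] [Finite (RelSymbol σ)]
    [IsEmpty (σ.Relations 0)] (A B : Type*) [σ.Structure A] [σ.Structure B] [Finite A] [Finite B]
    (x : A ⊕ B) : treeCounts σ A B → ℚ := fun f => f.1 x

open scoped Classical in
theorem indicator_treeColour_mem (c : treeCounts σ A B → ℚ) :
    (fun x => if treeColour σ A B x = c then (1 : ℚ) else 0) ∈
      Submodule.span ℚ (treeCounts σ A B : Set (A ⊕ B → ℚ)) := by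
  by_cases hc : ∃ x, treeColour σ A B x = c
  · obtain ⟨x, rfl⟩ := hc
    convert indicator_mem_span (treeCounts σ A B) x using 3
    rw [funext_iff, Subtype.forall]
    exact Iff.rfl
  · push Not at hc
    simp only [hc, if_false]
    exact Submodule.zero_mem _

/-- Möbius inversion as a downward induction on `π`: the star sum of the colour indicators is the
sum of the pattern counts over all `ρ ≥ π`, and those with `ρ > π` are already in the span. -/
theorem patternCount_mem_span (R : RelSymbol σ) (i : Fin R.1) (v : Fin R.1 → treeCounts σ A B → ℚ)
    (π : Setoid (Fin R.1)) :
    (Sum.elim (fun a => (patternCount (fun a => treeColour σ A B (.inl a)) R i π v a : ℚ))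
      (fun b => (patternCount (fun b => treeColour σ A B (.inr b)) R i π v b : ℚ))) ∈
      Submodule.span ℚ (treeCounts σ A B : Set (A ⊕ B → ℚ)) := by
  classical
  have hfin : Finite (Setoid (Fin R.1)) :=
    Finite.of_injective (fun ρ : Setoid (Fin R.1) => fun x y => ρ x y) fun ρ τ h =>
      Setoid.ext fun x y => iff_of_eq (congrFun (congrFun h x) y)
  have := Fintype.ofFinite (Setoid (Fin R.1))
  induction π using WellFoundedGT.induction with
  | ind π ih =>
    have h1 := starMap_mem_span (A := A) (B := B) R i π _ fun j => indicator_treeColour_mem (v j)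
    have h2 := Submodule.sum_mem _ (t := Finset.univ.filter fun ρ => π < ρ) fun ρ hρ =>
      ih ρ (Finset.mem_filter.1 hρ).2
    convert Submodule.sub_mem _ h1 h2 using 1
    have hset : (Finset.univ.filter fun ρ => π ≤ ρ) =
        insert π (Finset.univ.filter fun ρ => π < ρ) := by
      ext ρ
      simp [le_iff_eq_or_lt, eq_comm]
    funext x
    rw [Pi.sub_apply, Finset.sum_apply, eq_sub_iff_add_eq]
    rcases x with a | b
    · rw [starMap_inl]
      simp only [Sum.elim_inl]
      rw [sum_patternCount_Ici (fun a => treeColour σ A B (.inl a)), hset,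
        Finset.sum_insert (by simp)]
    · rw [starMap_inr]
      simp only [Sum.elim_inr]
      rw [sum_patternCount_Ici (fun a => treeColour σ A B (.inr a)), hset,
        Finset.sum_insert (by simp)]

/-- Colour indicators in the span give equal class sizes; pattern counts in the span are constant on
colours, since a colour records every tree count. -/
theorem SameFTreeHoms.haveCommonEquitablePartition (h : SameFTreeHoms σ A B) :
    HaveCommonEquitablePartition σ A B := by
  classical
  refine haveCommonEquitablePartition_of_patternCount (fun a => treeColour σ A B (.inl a))
    (fun b => treeColour σ A B (.inr b)) (fun c => ?_) fun a b hab R i π v => ?_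
  · have := sum_eq_of_mem_span_treeCounts h (indicator_treeColour_mem c)
    rw [Finset.sum_boole, Finset.sum_boole] at this
    exact Nat.cast_injective this
  · have := eq_of_mem_span (x := Sum.inl a) (y := Sum.inr b)
      (fun f hf => congrFun hab (⟨f, hf⟩ : treeCounts σ A B)) (patternCount_mem_span R i v π)
    exact Nat.cast_injective this

end Converse

end FracIso

theorem theorem1 (σ : FirstOrder.Language) [σ.IsRelational]
    [Finite (FracIso.RelSymbol σ)] [IsEmpty (σ.Relations 0)]
    (A B : Type*) [Fintype A] [Fintype B] [σ.Structure A] [σ.Structure B] :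
    List.TFAE
      [FracIso.MatrixCondition σ A B,
       FracIso.SameIterDegree σ A B,
       FracIso.HaveCommonEquitablePartition σ A B,
       FracIso.SameFTreeHoms σ A B] ∧
    ∀ E : σ.Relations 2, FracIso.IsGraph σ E A → FracIso.IsGraph σ E B →
      List.TFAE
        [FracIso.MatrixCondition σ A B,
         FracIso.SameIterDegree σ A B,
         FracIso.HaveCommonEquitablePartition σ A B,
         FracIso.SameFTreeHoms σ A B,
         FracIso.AdjCondition σ E A B] := by
  have h12 := FracIso.MatrixCondition.sameIterDegree (σ := σ) (A := A) (B := B)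
  have h23 := FracIso.SameIterDegree.haveCommonEquitablePartition (σ := σ) (A := A) (B := B)
  have h31 := FracIso.HaveCommonEquitablePartition.matrixCondition (σ := σ) (A := A) (B := B)
  have h34 := FracIso.HaveCommonEquitablePartition.sameFTreeHoms (σ := σ) (A := A) (B := B)
  have h43 : FracIso.SameFTreeHoms σ A B → FracIso.HaveCommonEquitablePartition σ A B :=
    FracIso.SameFTreeHoms.haveCommonEquitablePartition
  refine ⟨?_, fun E hA hB => ?_⟩
  · tfae_have 1 → 2 := h12
    tfae_have 2 → 3 := h23
    tfae_have 3 → 1 := h31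
    tfae_have 3 → 4 := h34
    tfae_have 4 → 3 := h43
    tfae_finish
  · tfae_have 1 → 2 := h12
    tfae_have 2 → 3 := h23
    tfae_have 3 → 1 := h31
    tfae_have 3 → 4 := h34
    tfae_have 4 → 3 := h43
    tfae_have 1 → 5 := FracIso.MatrixCondition.adjCondition hA hB
    tfae_have 5 → 3 := FracIso.AdjCondition.haveCommonEquitablePartition hA hB
    tfae_finish
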